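/- Let $k$ be an algebraically closed field of characteristic $0$ and let $C$ be a smooth curve over $k$ (a separated $k$-scheme, smooth of relative dimension $1$). All functors are functors on commutative $k$-algebras $R$. Let $\mathrm{Aut}^+O(R)$ be the group (under composition) of continuous $R$-algebra automorphisms $\rho$ of $R[[z]]$ with $\rho(zR[[z]])\subset zR[[z]]$, where $R[[z]]$ has the $z$-adic topology; it is functorial in $R$ by applying $R\to S$ to the coefficients of $\rho(z)$. Let $JC(R)=C(R[[z]])$, with the left action of $\mathrm{Aut}^+O(R)$ through its action on $R[[z]]$ and the projection $JC\to C$, $z\mapsto 0$. Let $\mathrm{Aut}_C(R)\subset JC(R)$ be the set of those $y$ for which the pullback of differentials $$\hat y^*\Omega^1_C=\varprojlim_n \big(y|_{\mathrm{Spec}\,R[z]/z^n}\big)^*\Omega^1_C\;\longrightarrow\;\Omega^{1,\mathrm{cont}}_{R[[z]]/R}=\varprojlim_n\Omega^1_{(R[z]/z^n)/R}$$ is an isomorphism. For an affine open $U=\mathrm{Spec}\,A\subset C$ and $x\in U(R)=\mathrm{Hom}_k(A,R)$ let $J_x$ be the kernel of $A\otimes_k R\to R$, $a\otimes r\mapsto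 x(a)r$, and $\mathcal T_xR=\varprojlim_n (A\otimes_k R)/J_x^n$ with its inverse limit topology. A coordinate on $U$ is a $t\in A$ with $\Omega^1_{A/k}=A\,dt$. (1) $\mathrm{Aut}_C$ is a subfunctor of $JC$ stable under $\mathrm{Aut}^+O$, and the projection $\mathrm{Aut}_C\to C$ exhibits it as a left $\mathrm{Aut}^+O$-torsor over $C$: the projection is $\mathrm{Aut}^+O$-invariant, $\mathrm{Aut}^+O(R)$ acts simply transitively on each non-empty fibre of $\mathrm{Aut}_C(R)\to C(R)$, and $C$ is covered by affine opens $U$ for which there is an $\mathrm{Aut}^+O$-equivariant isomorphism of functors $U\times\mathrm{Aut}^+O\simeq \mathrm{Aut}_C\times_C U$ over $U$. (2) Let $U=\mathrm{Spec}\,A$ be an affine open of $C$ (for instance $U=C$ if $C$ is affine) with a coordinate $t$. For every $R$ and $x\in U(R)$, sending $\varphi$ to the jet given by $A\to A\otimes_k R\to\mathcal T_xR\xrightarrow{\varphi}R[[z]]$ is a bijection from the set of isomorphisms of topological $R$-algebras $\varphi:\mathcal T_xR\to R[[z]]$ with $\varphi(J_x)\subset zR[[z]]$ onto the set of elements of $\mathrm{Aut}_C(R)$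 lying over $x$. Thus $\mathrm{Aut}_C(R)$ is, over $U$, the set of pairs $(x,\varphi)$. (3) In the situation of (2), for each $x\in U(R)$ there is exactly one such isomorphism $\rho^x_t:\mathcal T_xR\to R[[z]]$ with $(\rho^x_t)^{-1}(z)=t-x(t)$, and $\psi_t:U\times\mathrm{Aut}^+O\to\mathrm{Aut}_C\times_CU$, $(x,\rho)\mapsto(x,\rho\circ\rho^x_t)$, is an $\mathrm{Aut}^+O$-equivariant isomorphism of functors over $U$ (a trivialization); it sends $(x,1)$ to $(x,\rho^x_t)$. (4) If $t,s$ are two coordinates on $U=\mathrm{Spec}\,A$ and $\partial_t$ is the $k$-derivation of $A$ with $\partial_t t=1$ (which exists), then there is $u\in\mathrm{Aut}^+O(A)$ with $u(z)=\sum_{n\ge1}\frac1{n!}(\partial_t^n s)z^n$, and $\psi_s^{-1}\psi_t(x,\rho)=(x,\rho\cdot x(u))$ for all $R$, $x\in U(R)$ and $\rho\in\mathrm{Aut}^+O(R)$, where $x(u)\in\mathrm{Aut}^+O(R)$ is the image of $u$ under $x:A\to R$. -/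

import Mathlib

open CategoryTheory AlgebraicGeometry PowerSeries TensorProduct KaehlerDifferential
open scoped Topology

universe u

noncomputable section

namespace CurveJets

/-! ### The group functor `Aut⁺O` -/

section AutPlus

variable (R : Type u) [CommRing R]

/-- The ideal `𝔪_R = z R[[z]]`. -/
abbrev maxIdeal : Ideal R⟦X⟧ := Ideal.span {(X : R⟦X⟧)}

/-- The `z`-adic topology of `R[[z]]`. -/
abbrev zTop : TopologicalSpace R⟦X⟧ := (maxIdeal R).adicTopology

variable {R}

theorem map_mem_pow (σ : R⟦X⟧ →ₐ[R] R⟦X⟧) (h : ∀ g ∈ maxIdeal R, σ g ∈ maxIdeal R) (n : ℕ)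
    {g : R⟦X⟧} (hg : g ∈ maxIdeal R ^ n) : σ g ∈ maxIdeal R ^ n := by
  have h1 : (maxIdeal R ^ n).map σ.toRingHom ≤ maxIdeal R ^ n := by
    rw [Ideal.map_pow]
    refine Ideal.pow_right_mono ?_ n
    rw [Ideal.map_le_iff_le_comap]
    exact fun g hg => h g hg
  exact h1 (Ideal.mem_map_of_mem σ.toRingHom hg)

theorem continuous_of_map_mem (σ : R⟦X⟧ →ₐ[R] R⟦X⟧)
    (h : ∀ g ∈ maxIdeal R, σ g ∈ maxIdeal R) : Continuous[zTop R, zTop R] σ := by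
  let := zTop R
  have : IsTopologicalAddGroup R⟦X⟧ :=
    (maxIdeal R).adic_basis.toRing_subgroups_basis.toRingFilterBasis.isTopologicalAddGroup
  refine continuous_of_continuousAt_zero σ.toRingHom.toAddMonoidHom ?_
  rw [ContinuousAt, map_zero]
  refine ((maxIdeal R).hasBasis_nhds_zero_adic.tendsto_iff
    (maxIdeal R).hasBasis_nhds_zero_adic).2 fun n _ => ⟨n, trivial, fun g hg => ?_⟩
  exact map_mem_pow σ h n hg

/-- An `R`-algebra endomorphism of `R[[z]]` preserving `z R[[z]]` is determined by the image
of `z`. -/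
theorem algHom_ext (σ τ : R⟦X⟧ →ₐ[R] R⟦X⟧) (hσ : ∀ g ∈ maxIdeal R, σ g ∈ maxIdeal R)
    (hτ : ∀ g ∈ maxIdeal R, τ g ∈ maxIdeal R) (h : σ X = τ X) : σ = τ := by
  ext g n
  have hpoly : ∀ q : Polynomial R, σ (q : R⟦X⟧) = τ (q : R⟦X⟧) := by
    intro q
    have : σ.comp (Polynomial.coeToPowerSeries.algHom R) =
        τ.comp (Polynomial.coeToPowerSeries.algHom R) := by
      apply Polynomial.algHom_ext
      simpa using h
    simpa using congrArg (fun f => f q) this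
  have hsub : g - (trunc (n + 1) g : R⟦X⟧) ∈ maxIdeal R ^ (n + 1) := by
    rw [Ideal.span_singleton_pow, Ideal.mem_span_singleton, X_pow_dvd_iff]
    intro m hm
    simp [coeff_trunc, hm]
  have h1 := map_mem_pow σ hσ _ hsub
  have h2 := map_mem_pow τ hτ _ hsub
  have h3 := Ideal.sub_mem _ h1 h2
  rw [map_sub, map_sub, hpoly, sub_sub_sub_cancel_right, Ideal.span_singleton_pow,
    Ideal.mem_span_singleton, X_pow_dvd_iff] at h3
  have := h3 n (Nat.lt_succ_self n)
  rwa [map_sub, sub_eq_zero] at this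

theorem symm_map_mem (ρ : R⟦X⟧ ≃ₐ[R] R⟦X⟧) (h : ∀ g ∈ maxIdeal R, ρ g ∈ maxIdeal R) :
    ∀ g ∈ maxIdeal R, ρ.symm g ∈ maxIdeal R := by
  intro g hg
  have key : ρ.symm g - C (constantCoeff (ρ.symm g)) ∈ maxIdeal R := by
    rw [Ideal.mem_span_singleton, X_dvd_iff]; simp
  have h1 := h _ key
  rw [map_sub, AlgEquiv.apply_symm_apply] at h1
  have h2 : ρ (C (constantCoeff (ρ.symm g))) = C (constantCoeff (ρ.symm g)) :=
    ρ.commutes (constantCoeff (ρ.symm g))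
  have h3 := Ideal.sub_mem _ hg h1
  rw [h2, sub_sub_cancel, Ideal.mem_span_singleton, X_dvd_iff, constantCoeff_C] at h3
  rwa [Ideal.mem_span_singleton, X_dvd_iff]

variable (R) in
/-- `Aut⁺O(R)`: the group of continuous (with continuous inverse) `R`-algebra automorphisms `ρ` of
`R[[z]]` such that `ρ(𝔪_R) ⊆ 𝔪_R`. The group law is composition of automorphisms. -/
def AutPlus : Subgroup (R⟦X⟧ ≃ₐ[R] R⟦X⟧) where
  carrier := {ρ | Continuous[zTop R, zTop R] ρ ∧ Continuous[zTop R, zTop R] ρ.symm ∧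
    ∀ g ∈ maxIdeal R, ρ g ∈ maxIdeal R}
  mul_mem' := fun {a b} ha hb => by
    let := zTop R
    exact ⟨ha.1.comp hb.1, hb.2.1.comp ha.2.1, fun g hg => ha.2.2 _ (hb.2.2 _ hg)⟩
  one_mem' := by
    let := zTop R
    exact ⟨continuous_id, continuous_id, fun g hg => hg⟩
  inv_mem' := fun {a} ha => ⟨ha.2.1, ha.1, symm_map_mem a ha.2.2⟩

variable {S : Type u} [CommRing S]

theorem hasSubst_map (f : R →+* S) (ρ : AutPlus R) :
    HasSubst (PowerSeries.map f (ρ.1 X)) := by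
  apply HasSubst.of_constantCoeff_zero'
  have h := ρ.2.2.2 X (Ideal.mem_span_singleton_self _)
  rw [Ideal.mem_span_singleton, X_dvd_iff] at h
  rw [← coeff_zero_eq_constantCoeff_apply, coeff_map, coeff_zero_eq_constantCoeff_apply, h,
    map_zero]

/-- The `S`-algebra endomorphism `z ↦ f(ρ(z))` of `S[[z]]`. -/
def mapHom (f : R →+* S) (ρ : AutPlus R) : S⟦X⟧ →ₐ[S] S⟦X⟧ :=
  substAlgHom (hasSubst_map f ρ)

theorem mapHom_X (f : R →+* S) (ρ : AutPlus R) :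
    mapHom f ρ X = PowerSeries.map f (ρ.1 X) :=
  substAlgHom_X (hasSubst_map f ρ)

theorem mapHom_mem (f : R →+* S) (ρ : AutPlus R) :
    ∀ g ∈ maxIdeal S, mapHom f ρ g ∈ maxIdeal S := by
  intro g hg
  obtain ⟨a, rfl⟩ := Ideal.mem_span_singleton.1 hg
  rw [map_mul, mapHom_X]
  refine Ideal.mul_mem_right _ _ ?_
  obtain ⟨b, hb⟩ := Ideal.mem_span_singleton.1 (ρ.2.2.2 X (Ideal.mem_span_singleton_self _))
  rw [hb, map_mul, map_X]
  exact Ideal.mul_mem_right _ _ (Ideal.mem_span_singleton_self _)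

theorem eq_subst (ρ : AutPlus R) (g : R⟦X⟧) : ρ.1 g = g.subst (ρ.1 X) := by
  have h := hasSubst_map (RingHom.id R) ρ
  have e : PowerSeries.map (RingHom.id R) (ρ.1 X) = ρ.1 X := by simp
  have := algHom_ext ρ.1.toAlgHom (mapHom (RingHom.id R) ρ) ρ.2.2.2 (mapHom_mem _ ρ)
    (by rw [mapHom_X, e]; rfl)
  have h2 := congrArg (fun σ => σ g) this
  change ρ.1 g = substAlgHom h g at h2
  rw [h2, coe_substAlgHom, e]

theorem mapHom_map (f : R →+* S) (ρ : AutPlus R) (g : R⟦X⟧) :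
    mapHom f ρ (PowerSeries.map f g) = PowerSeries.map f (ρ.1 g) := by
  have h := hasSubst_map (RingHom.id R) ρ
  have e : PowerSeries.map (RingHom.id R) (ρ.1 X) = ρ.1 X := by simp
  rw [e] at h
  rw [eq_subst ρ g, mapHom, coe_substAlgHom]
  exact (map_subst h g).symm

theorem mapHom_mul (f : R →+* S) (ρ τ : AutPlus R) :
    (mapHom f ρ).comp (mapHom f τ) = mapHom f (ρ * τ) := by
  refine algHom_ext _ _ (fun g hg => mapHom_mem f ρ _ (mapHom_mem f τ g hg)) (mapHom_mem _ _) ?_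
  rw [AlgHom.comp_apply, mapHom_X, mapHom_X, mapHom_map]
  rfl

theorem mapHom_one (f : R →+* S) : mapHom f (1 : AutPlus R) = AlgHom.id S S⟦X⟧ := by
  refine algHom_ext _ _ (mapHom_mem _ _) (fun g hg => hg) ?_
  rw [mapHom_X]
  exact map_X f

/-- Functoriality of `Aut⁺O`: for `f : R → S`, the automorphism `ρ` of `R[[z]]` goes to the
automorphism of `S[[z]]` with `z ↦ f(ρ(z))`. -/
def AutPlus.map (f : R →+* S) : AutPlus R →* AutPlus S where
  toFun ρ :=
    ⟨AlgEquiv.ofAlgHom (mapHom f ρ) (mapHom f ρ⁻¹)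
      (by rw [mapHom_mul, mul_inv_cancel, mapHom_one])
      (by rw [mapHom_mul, inv_mul_cancel, mapHom_one]),
      continuous_of_map_mem _ (mapHom_mem f ρ), continuous_of_map_mem _ (mapHom_mem f ρ⁻¹),
      mapHom_mem f ρ⟩
  map_one' := by
    apply Subtype.ext
    ext1 g
    exact congrArg (fun σ => σ g) (mapHom_one f)
  map_mul' ρ τ := by
    apply Subtype.ext
    ext1 g
    exact congrArg (fun σ => σ g) (mapHom_mul f ρ τ).symm

end AutPlus

/-! ### Points, jets and the action of `Aut⁺O` -/

section Points

variable {k : Type u} [Field k] {C : Scheme.{u}} (p : C ⟶ Spec (CommRingCat.of k))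

/-- `C(R)`: the morphisms `Spec R ⟶ C` over `k`, for a `k`-scheme `p : C ⟶ Spec k`. -/
def Pt (R : Type u) [CommRing R] [Algebra k R] : Type u :=
  {x : Spec (CommRingCat.of R) ⟶ C // x ≫ p = Spec.map (CommRingCat.ofHom (algebraMap k R))}

/-- `JC(R) = C(R[[z]])`. -/
abbrev Jet (R : Type u) [CommRing R] [Algebra k R] : Type u := Pt p R⟦X⟧

variable {p} {R S : Type u} [CommRing R] [Algebra k R] [CommRing S] [Algebra k S]

/-- Functoriality of `C(-)`. -/
def Pt.map (f : R →ₐ[k] S) (x : Pt p R) : Pt p S :=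
  ⟨Spec.map (CommRingCat.ofHom f.toRingHom) ≫ x.1, by
    rw [Category.assoc, x.2, ← Spec.map_comp, ← CommRingCat.ofHom_comp]
    exact congrArg (fun g => Spec.map (CommRingCat.ofHom g)) f.comp_algebraMap⟩

/-- Functoriality of `JC(-)`. -/
def Jet.map (f : R →ₐ[k] S) (y : Jet p R) : Jet p S := Pt.map (PowerSeries.mapAlgHom f) y

variable (k R) in
/-- The `k`-algebra map `R[[z]] → R`, `z ↦ 0`. -/
def evalZero : R⟦X⟧ →ₐ[k] R where
  __ := (constantCoeff : R⟦X⟧ →+* R)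
  commutes' c := by
    change constantCoeff (algebraMap k R⟦X⟧ c) = _
    rw [IsScalarTower.algebraMap_apply k R R⟦X⟧]
    exact constantCoeff_C _

/-- The projection `JC → C`. -/
def Jet.base (y : Jet p R) : Pt p R := Pt.map (evalZero k R) y

/-- The left action of `Aut⁺O(R)` on `JC(R) = C(R[[z]])` through the action of `Aut⁺O(R)` on
`R[[z]]`. -/
instance : MulAction (AutPlus R) (Jet p R) where
  smul ρ y := Pt.map (ρ.1.toAlgHom.restrictScalars k) y
  one_smul y := by
    apply Subtype.ext
    change Spec.map (𝟙 _) ≫ y.1 = y.1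
    rw [Spec.map_id, Category.id_comp]
  mul_smul ρ τ y := by
    apply Subtype.ext
    change Spec.map (CommRingCat.ofHom (τ.1.toAlgHom.restrictScalars k).toRingHom ≫
      CommRingCat.ofHom (ρ.1.toAlgHom.restrictScalars k).toRingHom) ≫ y.1 = Spec.map _ ≫ Spec.map _ ≫ y.1
    rw [Spec.map_comp, Category.assoc]

end Points

/-! ### The subfunctor `Aut_C` of `JC` -/

section Differentials

variable (k R A : Type u) [Field k] [CommRing R] [Algebra k R] [CommRing A] [Algebra k A]

/-- `R[z]/zⁿ`, as a quotient of `R[[z]]`. -/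
abbrev TruncPS (n : ℕ) : Type u := R⟦X⟧ ⧸ maxIdeal R ^ n

variable {R} in
/-- For a map of `R`-algebras `B → B'`, the map `Ω¹_{B/R} → Ω¹_{B'/R}`. -/
def omegaMap {B B' : Type u} [CommRing B] [CommRing B'] [Algebra R B] [Algebra R B']
    (f : B →ₐ[R] B') : Ω[B⁄R] →ₗ[R] Ω[B'⁄R] :=
  letI := f.toRingHom.toAlgebra
  haveI : IsScalarTower R B B' := IsScalarTower.of_algebraMap_eq fun r => (f.commutes r).symm
  (KaehlerDifferential.map R R B B').restrictScalars R

/-- `Ω^{1,cont}_{R[[z]]/R} = lim_n Ω¹_{(R[z]/zⁿ)/R}`, as compatible families. -/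
def ContOmega : Type u :=
  {w : ∀ n, Ω[TruncPS R n⁄R] //
    ∀ n, omegaMap (Ideal.Quotient.factorₐ R (Ideal.pow_le_pow_right n.le_succ)) (w (n + 1)) = w n}

variable [Algebra A R⟦X⟧] [IsScalarTower k A R⟦X⟧]

/-- For a `k`-algebra map `A → R[[z]]`, i.e. a jet `x` of `Spec A`, the module
`x̂^*Ω¹_A = lim_n (R[z]/zⁿ ⊗_A Ω¹_{A/k})`, as compatible families. -/
def PullbackOmega : Type u :=
  {w : ∀ n, TruncPS R n ⊗[A] Ω[A⁄k] //
    ∀ n, LinearMap.rTensor Ω[A⁄k]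
      (Ideal.Quotient.factorₐ A (Ideal.pow_le_pow_right n.le_succ)).toLinearMap (w (n + 1)) = w n}

/-- The pullback of differentials `R[z]/zⁿ ⊗_A Ω¹_{A/k} → Ω¹_{(R[z]/zⁿ)/R}`,
`b ⊗ da ↦ b d(x(a))`. -/
def pullbackMapTrunc (n : ℕ) : TruncPS R n ⊗[A] Ω[A⁄k] →ₗ[TruncPS R n] Ω[TruncPS R n⁄R] :=
  haveI : IsScalarTower k A (TruncPS R n) := inferInstance
  haveI : IsScalarTower k R (TruncPS R n) := inferInstance
  (KaehlerDifferential.map k R A (TruncPS R n)).liftBaseChange (TruncPS R n)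

theorem omegaMap_pullbackMapTrunc (n : ℕ) (w : TruncPS R (n + 1) ⊗[A] Ω[A⁄k]) :
    omegaMap (Ideal.Quotient.factorₐ R (Ideal.pow_le_pow_right n.le_succ))
      (pullbackMapTrunc k R A (n + 1) w) =
    pullbackMapTrunc k R A n (LinearMap.rTensor Ω[A⁄k]
      (Ideal.Quotient.factorₐ A (Ideal.pow_le_pow_right n.le_succ)).toLinearMap w) := by
  induction w using TensorProduct.induction_on with
  | zero => simp
  | add a b ha hb => rw [map_add, map_add, ha, hb, map_add, map_add]
  | tmul b ω =>
    have hω : ω ∈ Submodule.span A (Set.range (D k A)) := by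
      rw [KaehlerDifferential.span_range_derivation]; trivial
    induction hω using Submodule.span_induction generalizing b with
    | zero => simp
    | add a c _ _ ha hc =>
      rw [TensorProduct.tmul_add, map_add, map_add, ha, hc, map_add, map_add]
    | smul a c _ hc =>
      rw [← TensorProduct.smul_tmul]
      exact hc _
    | mem c hc =>
      obtain ⟨a, rfl⟩ := hc
      simp only [pullbackMapTrunc, omegaMap, LinearMap.liftBaseChange_tmul,
        KaehlerDifferential.map_D, LinearMap.rTensor_tmul, LinearMap.restrictScalars_apply,
        map_smul]
      rfl

/-- The pullback of differentials `x̂^*Ω¹_A → Ω^{1,cont}_{R[[z]]/R}`. -/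
def pullbackMap (w : PullbackOmega k R A) : ContOmega R :=
  ⟨fun n => pullbackMapTrunc k R A n (w.1 n), fun n => by
    rw [omegaMap_pullbackMapTrunc, w.2 n]⟩

end Differentials

section AutC

/-- For a jet `φ : A → R[[z]]` of `Spec A`, the map `x̂^*Ω¹_A → Ω^{1,cont}_{R[[z]]/R}` is an
isomorphism. -/
def IsIsoOnOmega {k R A : Type u} [Field k] [CommRing R] [Algebra k R] [CommRing A] [Algebra k A]
    (φ : A →ₐ[k] R⟦X⟧) : Prop :=
  letI := φ.toRingHom.toAlgebra
  haveI : IsScalarTower k A R⟦X⟧ := IsScalarTower.of_algebraMap_eq fun c => (φ.commutes c).symm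
  Function.Bijective (pullbackMap k R A)

variable {k : Type u} [Field k] {C : Scheme.{u}} (p : C ⟶ Spec (CommRingCat.of k))

/-- `Aut_C(R)`, the set of those jets `y ∈ JC(R) = C(R[[z]])` for which
`ŷ^*Ω¹_C → Ω^{1,cont}_{R[[z]]/R}` is an isomorphism. For a general `C` this is a map of sheaves on
the formal spectrum of `R[[z]]`, whose underlying space is `Spec R`. It is an isomorphism
iff it is one over each `D(f) ⊆ Spec R` on which `y` factors through an affine open `Spec A` of
`C`; there `y` is given by a map `φ : A → R_f[[z]]`, and the map of sheaves is
`lim_n (R_f[z]/zⁿ ⊗_A Ω¹_{A/k}) → lim_n Ω¹_{(R_f[z]/zⁿ)/R_f}`.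
(An affine open of `C` is given as an `A`-point `j` of `C` which is an open immersion.) -/
def AutC (R : Type u) [CommRing R] [Algebra k R] : Set (Jet p R) :=
  {y | ∀ (A : Type u) [CommRing A] [Algebra k A] (j : Pt p A) [IsOpenImmersion j.1] (f : R)
    (φ : A →ₐ[k] (Localization.Away f)⟦X⟧),
    Jet.map (IsScalarTower.toAlgHom k R (Localization.Away f)) y = Pt.map φ j →
      IsIsoOnOmega φ}

end AutC

/-! ### Torsors -/

section Torsor

variable {k : Type u} [Field k] {C : Scheme.{u}} {p : C ⟶ Spec (CommRingCat.of k)}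

/-- Let `P` be a family of subsets of the sets `JC(R)`, and let `j : Spec A ⟶ C` be an
affine open `U` of `C`. The maps `ψ_R : U(R) × Aut⁺O(R) → JC(R)` (where `U(R) = Hom_k(A, R)`) are
an `Aut⁺O`-equivariant isomorphism of functors `U × Aut⁺O ≃ P ×_C U` over `U`. -/
structure IsTrivialization (P : ∀ (R : Type u) [CommRing R] [Algebra k R], Set (Jet p R))
    {A : Type u} [CommRing A] [Algebra k A] (j : Pt p A)
    (ψ : ∀ (R : Type u) [CommRing R] [Algebra k R], (A →ₐ[k] R) → AutPlus R → Jet p R) : Prop where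
  /-- `ψ_R` is over `U`, and is bijective over each point `x` of `U(R)`. -/
  bijOn : ∀ (R : Type u) [CommRing R] [Algebra k R] (x : A →ₐ[k] R),
    Set.BijOn (ψ R x) Set.univ {y | y ∈ P R ∧ y.base = Pt.map x j}
  equivariant : ∀ (R : Type u) [CommRing R] [Algebra k R] (x : A →ₐ[k] R) (σ ρ : AutPlus R),
    ψ R x (σ * ρ) = σ • ψ R x ρ
  natural : ∀ (R S : Type u) [CommRing R] [Algebra k R] [CommRing S] [Algebra k S]
    (f : R →ₐ[k] S) (x : A →ₐ[k] R) (ρ : AutPlus R),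
    Jet.map f (ψ R x ρ) = ψ S (f.comp x) (AutPlus.map f.toRingHom ρ)

/-- The family `P` of subsets of the sets `JC(R)` is a subfunctor of `JC` stable under the left
action of `Aut⁺O`, and the projection `P → C` makes it a left `Aut⁺O`-torsor over `C`: the
projection is invariant, the action is simply transitive on the fibres of `P(R) → C(R)`,
and `P` is trivial Zariski locally on `C`. -/
structure IsLeftTorsor (P : ∀ (R : Type u) [CommRing R] [Algebra k R], Set (Jet p R)) : Prop where
  map_mem : ∀ (R S : Type u) [CommRing R] [Algebra k R] [CommRing S] [Algebra k S]
    (f : R →ₐ[k] S) (y : Jet p R), y ∈ P R → Jet.map f y ∈ P S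
  smul_mem : ∀ (R : Type u) [CommRing R] [Algebra k R] (ρ : AutPlus R) (y : Jet p R),
    y ∈ P R → ρ • y ∈ P R
  map_smul : ∀ (R S : Type u) [CommRing R] [Algebra k R] [CommRing S] [Algebra k S]
    (f : R →ₐ[k] S) (ρ : AutPlus R) (y : Jet p R), y ∈ P R →
    Jet.map f (ρ • y) = AutPlus.map f.toRingHom ρ • Jet.map f y
  base_smul : ∀ (R : Type u) [CommRing R] [Algebra k R] (ρ : AutPlus R) (y : Jet p R),
    y ∈ P R → (ρ • y).base = y.base
  simply_transitive : ∀ (R : Type u) [CommRing R] [Algebra k R] (y y' : Jet p R),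
    y ∈ P R → y' ∈ P R → y.base = y'.base → ∃! ρ : AutPlus R, ρ • y = y'
  locally_trivial : ∀ c : C, ∃ (A : Type u) (_ : CommRing A) (_ : Algebra k A) (j : Pt p A),
    IsOpenImmersion j.1 ∧ c ∈ Set.range j.1 ∧
    ∃ ψ : ∀ (R : Type u) [CommRing R] [Algebra k R], (A →ₐ[k] R) → AutPlus R → Jet p R,
      IsTrivialization P j ψ

end Torsor

/-! ### The completion `𝒯_x R` -/

section Completion

variable {k R A : Type u} [Field k] [CommRing R] [Algebra k R] [CommRing A] [Algebra k A]

variable (k) in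
/-- `t` is a coordinate on `Spec A`: `Ω¹_A = A dt`. -/
def IsCoordinate (t : A) : Prop := Submodule.span A {D k A t} = ⊤

/-- The ideal `J_x` of `R ⊗ A`, for an `R`-point `x` of `Spec A`: the kernel of
`R ⊗ A → R`, `r ⊗ a ↦ r x(a)`. -/
def pointIdeal (x : A →ₐ[k] R) : Ideal (R ⊗[k] A) :=
  RingHom.ker (Algebra.TensorProduct.lift (AlgHom.id R R) x fun _ _ => Commute.all _ _)

/-- `𝒯_x R = lim_n (R ⊗ A) / J_xⁿ`. -/
abbrev PtCompletion (x : A →ₐ[k] R) : Type u := AdicCompletion (pointIdeal x) (R ⊗[k] A)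

/-- The topology of `𝒯_x R`: the inverse limit of the discrete topologies. -/
abbrev completionTop (x : A →ₐ[k] R) : TopologicalSpace (PtCompletion x) :=
  ⨅ n : ℕ, TopologicalSpace.induced (AdicCompletion.evalₐ (pointIdeal x) n) ⊥

/-- The isomorphisms of topological `R`-algebras `φ : 𝒯_x R ≃ R[[z]]` with
`φ(J_x) ⊆ z R[[z]]`. -/
def FormalIso (x : A →ₐ[k] R) : Type u :=
  {φ : PtCompletion x ≃ₐ[R] R⟦X⟧ // Continuous[completionTop x, zTop R] φ ∧
    Continuous[zTop R, completionTop x] φ.symm ∧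
    ∀ a ∈ pointIdeal x, φ (algebraMap (R ⊗[k] A) (PtCompletion x) a) ∈ maxIdeal R}

/-- `(ρ, φ) ↦ ρ ∘ φ`. -/
def FormalIso.act {x : A →ₐ[k] R} (ρ : AutPlus R) (φ : FormalIso x) : FormalIso x :=
  ⟨φ.1.trans ρ.1, by
    let := zTop R
    let := completionTop x
    exact ⟨ρ.2.1.comp φ.2.1, φ.2.2.1.comp ρ.2.2.1, fun a ha => ρ.2.2.2 _ (φ.2.2.2 a ha)⟩⟩

/-- `φ : 𝒯_x R ≃ R[[z]]` is the isomorphism `ρ^x_t`, i.e. `φ⁻¹(z) = t - x(t)`. -/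
def FormalIso.IsRho {x : A →ₐ[k] R} (t : A) (φ : FormalIso x) : Prop :=
  φ.1.symm X = algebraMap (R ⊗[k] A) (PtCompletion x) (1 ⊗ₜ[k] t - x t ⊗ₜ[k] 1)

/-- The `k`-algebra map `A → R ⊗ A → 𝒯_x R → R[[z]]` defined by `φ : 𝒯_x R ≃ R[[z]]`. -/
def FormalIso.toHom {x : A →ₐ[k] R} (φ : FormalIso x) : A →ₐ[k] R⟦X⟧ :=
  (φ.1.toAlgHom.restrictScalars k).comp
    ((IsScalarTower.toAlgHom k (R ⊗[k] A) (PtCompletion x)).comp Algebra.TensorProduct.includeRight)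

variable {C : Scheme.{u}} {p : C ⟶ Spec (CommRingCat.of k)}

/-- The jet of `C` defined by a pair `(x, φ)`, where `x` is an `R`-point of an affine open
`j : Spec A ⟶ C` and `φ : 𝒯_x R ≃ R[[z]]`. -/
def FormalIso.toJet (j : Pt p A) {x : A →ₐ[k] R} (φ : FormalIso x) : Jet p R :=
  Pt.map φ.toHom j

end Completion

end CurveJets

end

open CurveJets

noncomputable section

namespace CurveJets

/-! ### Linear terms and construction of elements of `Aut⁺O`. -/

section AutPlus

variable {R S : Type u} [CommRing R] [CommRing S]

/-! The condition on differentials is a condition on first derivatives. In characteristic 0, `Ω¹` of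
`R[z]/zⁿ⁺¹` over `R` is `R[z]/zⁿ · dz`. So for a jet `φ : A → R[[z]]` the map on differentials
becomes, in the limit, `b ⊗ da ↦ b · dφ(a)/dz` from a locally cyclic module to `R[[z]]`. Such a map
is bijective as soon as it is surjective, and surjectivity only depends on `z = 0`: the linear
coefficients of the `φ(a)` must generate the unit ideal `jetIdeal φ` of `R` (`isIsoOnOmega_iff`). If
`t` is a coordinate, this says that the linear coefficient of `φ(t)` is a unit
(`jetIdeal_eq_top_iff`).

With a coordinate `t`, a jet is determined by its base point `x` and by `φ(t)`
(`IsCoordinate.jet_ext`). The Taylor series `a ↦ ∑ x(∂ⁿa) zⁿ/n!` is a jet with `t ↦ x(t) + z`. Since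
`J_x` is generated by `t - x(t)` modulo `J_x²`, this jet induces isomorphisms `(R ⊗ A)/J_xⁿ ≃
R[z]/zⁿ`, hence `ρ^x_t : 𝒯_x R ≃ R[[z]]` (`exists_formalIso`). Every other isomorphism is `ρ ∘
ρ^x_t` with `ρ` in `Aut⁺O(R)`, and every jet at `x` for which the linear coefficient at `t` is a
unit arises in this way, because a series with zero constant term and unit linear coefficient is
`ρ(z)` for some `ρ`. This gives the description by pairs (`bijOn_toJet`) and the trivialization. The
change of coordinates is the Taylor expansion of `s`.

For the global statements, `jetIdeal` must not depend on the chart (`jetIdeal_eq_of_pt_map_eq`) and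
must be compatible with base change. Simple transitivity over an arbitrary `R`-point, which need not
lie in one chart, follows by gluing the unique local automorphisms coefficient by coefficient
(`existsUnique_smul_eq`). -/

theorem mem_maxIdeal_iff {g : R⟦X⟧} : g ∈ maxIdeal R ↔ constantCoeff g = 0 := by
  rw [Ideal.mem_span_singleton, X_dvd_iff]

theorem mem_maxIdeal_pow_iff {g : R⟦X⟧} {n : ℕ} :
    g ∈ maxIdeal R ^ n ↔ ∀ m < n, coeff m g = 0 := by
  rw [Ideal.span_singleton_pow, Ideal.mem_span_singleton, X_pow_dvd_iff]

theorem AutPlus.constantCoeff_apply (ρ : AutPlus R) (g : R⟦X⟧) :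
    constantCoeff (ρ.1 g) = constantCoeff g := by
  have h := ρ.2.2.2 (g - C (constantCoeff g)) (mem_maxIdeal_iff.2 (by simp))
  have hC : ρ.1 (C (constantCoeff g)) = C (constantCoeff g) := ρ.1.commutes _
  rw [map_sub, hC, mem_maxIdeal_iff, map_sub, constantCoeff_C, sub_eq_zero] at h
  exact h

/-- The chain rule at `z = 0`: write `g = c + z h` and `ρ(z) = z v`, and read off the linear term of
`c + z v ρ(h)`. Applied to `ρ⁻¹(z)`, it shows that the linear coefficient of `ρ(z)` is a unit. -/
theorem AutPlus.coeff_one_apply (ρ : AutPlus R) (g : R⟦X⟧) :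
    coeff 1 (ρ.1 g) = coeff 1 (ρ.1 X) * coeff 1 g := by
  obtain ⟨h, hh⟩ : X ∣ g - C (constantCoeff g) := by rw [X_dvd_iff]; simp
  have hg : g = C (constantCoeff g) + X * h := by rw [← hh]; ring
  have hC : ρ.1 (C (constantCoeff g)) = C (constantCoeff g) := ρ.1.commutes _
  have h0 : constantCoeff (ρ.1 X) = 0 := by rw [AutPlus.constantCoeff_apply ρ]; simp
  obtain ⟨v, hv⟩ := X_dvd_iff.2 h0
  have e1 : ∀ f : R⟦X⟧, coeff 1 (X * f) = constantCoeff f := fun f => by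
    rw [show 1 = 0 + 1 from rfl, coeff_succ_X_mul, coeff_zero_eq_constantCoeff_apply]
  have e2 : ∀ r : R, coeff 1 (C r) = 0 := fun r => by simp
  have h1 : coeff 1 g = constantCoeff h := by rw [hg, map_add, e2, e1, zero_add]
  rw [h1]
  conv_lhs => rw [hg, map_add, hC, map_mul, hv, map_add, e2, zero_add, mul_assoc, e1, map_mul,
    AutPlus.constantCoeff_apply ρ]
  rw [hv, e1]

theorem AutPlus.isUnit_coeff_one (ρ : AutPlus R) : IsUnit (coeff 1 (ρ.1 X)) := by
  refine IsUnit.of_mul_eq_one (coeff 1 ((ρ⁻¹).1 X)) ?_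
  rw [← AutPlus.coeff_one_apply ρ]
  change coeff 1 (ρ.1 (ρ.1.symm X)) = 1
  simp

theorem AutPlus.ext_X {ρ τ : AutPlus R} (h : ρ.1 X = τ.1 X) : ρ = τ := by
  apply Subtype.ext
  ext1 g
  exact congrArg (fun σ => σ g) (algHom_ext ρ.1.toAlgHom τ.1.toAlgHom ρ.2.2.2 τ.2.2.2 h)

theorem AutPlus.map_apply_map (f : R →+* S) (ρ : AutPlus R) (g : R⟦X⟧) :
    (AutPlus.map f ρ).1 (PowerSeries.map f g) = PowerSeries.map f (ρ.1 g) :=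
  mapHom_map f ρ g

theorem AutPlus.map_apply_X (f : R →+* S) (ρ : AutPlus R) :
    (AutPlus.map f ρ).1 X = PowerSeries.map f (ρ.1 X) :=
  mapHom_X f ρ

/-- A power series without constant term and with invertible linear coefficient is the image of `z`
under an element of `Aut⁺O`. -/
theorem AutPlus.exists_apply_X (g : R⟦X⟧) (h0 : constantCoeff g = 0) (h1 : IsUnit (coeff 1 g)) :
    ∃ ρ : AutPlus R, ρ.1 X = g := by
  have hg : HasSubst g := HasSubst.of_constantCoeff_zero' h0
  -- The inverse automorphism is substitution of the compositional inverse of `g`, which exists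
  -- because the linear coefficient is a unit.
  have hi : HasSubst (g.substInvOfIsUnit h1) := HasSubst.substInvOfIsUnit g h1
  have mem : ∀ (a : R⟦X⟧) (ha : HasSubst a), constantCoeff a = 0 →
      ∀ f ∈ maxIdeal R, substAlgHom ha f ∈ maxIdeal R := by
    intro a ha ha0 f hf
    obtain ⟨b, rfl⟩ := Ideal.mem_span_singleton.1 hf
    rw [map_mul, substAlgHom_X]
    exact Ideal.mul_mem_right _ _ (mem_maxIdeal_iff.2 ha0)
  have m1 := mem g hg h0
  have m2 := mem _ hi (by simp)
  refine ⟨⟨AlgEquiv.ofAlgHom (substAlgHom hg) (substAlgHom hi) ?_ ?_, continuous_of_map_mem _ m1,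
    continuous_of_map_mem _ m2, m1⟩, substAlgHom_X hg⟩
  · refine algHom_ext _ _ (fun f hf => m1 _ (m2 _ hf)) (fun f hf => hf) ?_
    rw [AlgHom.comp_apply, substAlgHom_X, coe_substAlgHom]
    exact subst_substInvOfIsUnit_left g h0 h1
  · refine algHom_ext _ _ (fun f hf => m2 _ (m1 _ hf)) (fun f hf => hf) ?_
    rw [AlgHom.comp_apply, substAlgHom_X, coe_substAlgHom]
    exact subst_substInvOfIsUnit_right g h0 h1

end AutPlus

/-! ### Derivations and coordinates -/

section Coordinate

variable {k R A : Type u} [Field k] [CommRing R] [Algebra k R] [CommRing A] [Algebra k A]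

/-- A derivation factors through `Ω¹`, which `dt` generates. All later uniqueness arguments for
coordinates build a suitable derivation and apply this. -/
theorem IsCoordinate.derivation_eq_zero {t : A} (ht : IsCoordinate k t) {M : Type*}
    [AddCommGroup M] [Module k M] [Module A M] [IsScalarTower k A M] (d : Derivation k A M)
    (h : d t = 0) (a : A) : d a = 0 := by
  have : D k A a ∈ Submodule.span A {D k A t} := by rw [ht]; trivial
  obtain ⟨c, hc⟩ := Submodule.mem_span_singleton.1 this
  rw [← d.liftKaehlerDifferential_comp_D, ← hc, map_smul, d.liftKaehlerDifferential_comp_D, h,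
    smul_zero]

theorem coeff_mul_of_mem_maxIdeal_pow {n : ℕ} (f : R⟦X⟧) {g : R⟦X⟧} (hg : g ∈ maxIdeal R ^ n) :
    coeff n (f * g) = constantCoeff f * coeff n g := by
  rw [Ideal.span_singleton_pow, Ideal.mem_span_singleton] at hg
  obtain ⟨h, rfl⟩ := hg
  have e : ∀ p : R⟦X⟧, coeff n (X ^ n * p) = constantCoeff p := fun p => by
    simpa using coeff_X_pow_mul p n 0
  rw [mul_left_comm, e, e, map_mul]

/-- Two jets with the same base point and the same value at a coordinate are equal. -/
theorem IsCoordinate.jet_ext {t : A} (ht : IsCoordinate k t) {φ ψ : A →ₐ[k] R⟦X⟧}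
    (h0 : ∀ a, constantCoeff (φ a) = constantCoeff (ψ a)) (h : φ t = ψ t) : φ = ψ := by
  suffices H : ∀ n a, coeff n (φ a) = coeff n (ψ a) from
    AlgHom.ext fun a => PowerSeries.ext fun n => H n a
  intro n
  induction n using Nat.strong_induction_on with
  | _ n ih =>
    intro a
    rcases Nat.eq_zero_or_pos n with rfl | hn
    · simpa using h0 a
    let : Module A R := Module.compHom R ((evalZero k R).comp φ).toRingHom
    have hsmul : ∀ (a : A) (r : R), a • r = constantCoeff (φ a) * r := fun _ _ => rfl
    have : IsScalarTower k A R := ⟨fun c a r => by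
      rw [hsmul, hsmul, map_smul, ← coeff_zero_eq_constantCoeff_apply, coeff_smul,
        coeff_zero_eq_constantCoeff_apply, smul_mul_assoc]⟩
    have hmem : ∀ a, φ a - ψ a ∈ maxIdeal R ^ n := fun a =>
      mem_maxIdeal_pow_iff.2 fun m hm => by rw [map_sub, ih m hm a, sub_self]
    -- If `φ` and `ψ` agree below degree `n`, the degree `n` part of their difference is a
    -- derivation of `A` at the common base point: in `φ(a)(φ(b) - ψ(b)) + ψ(b)(φ(a) - ψ(a))` only
    -- the constant terms of `φ(a)` and `ψ(b)` contribute in degree `n`.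
    let d : Derivation k A R := Derivation.mk'
      { toFun := fun a => coeff n (φ a - ψ a)
        map_add' := fun a b => by
          rw [map_add, map_add, add_sub_add_comm, map_add]
        map_smul' := fun c a => by
          rw [map_smul, map_smul, ← smul_sub, coeff_smul, RingHom.id_apply] }
      (fun a b => by
        change coeff n (φ (a * b) - ψ (a * b)) =
          a • coeff n (φ b - ψ b) + b • coeff n (φ a - ψ a)
        rw [show φ (a * b) - ψ (a * b) = φ a * (φ b - ψ b) + ψ b * (φ a - ψ a) by
          rw [map_mul, map_mul]; ring, map_add, coeff_mul_of_mem_maxIdeal_pow _ (hmem b),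
          coeff_mul_of_mem_maxIdeal_pow _ (hmem a), hsmul, hsmul, h0 b])
    have := ht.derivation_eq_zero d (by change coeff n (φ t - ψ t) = 0; simp [h]) a
    change coeff n (φ a - ψ a) = 0 at this
    rwa [map_sub, sub_eq_zero] at this

end Coordinate

/-! ### Taylor series -/

section Taylor

variable {k R A : Type u} [Field k] [CommRing A] [Algebra k A] [CommRing R] [Algebra k R]

/-- The Taylor series `∑ dⁿ(a) zⁿ / n!`. -/
def taylorSeries (d : Derivation k A A) (a : A) : A⟦X⟧ :=
  PowerSeries.mk fun n => algebraMap k A (n.factorial : k)⁻¹ * d^[n] a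

theorem isUnit_natCast_succ (k A : Type u) [Field k] [CharZero k] [CommRing A] [Algebra k A]
    (n : ℕ) : IsUnit ((n : A) + 1) := by
  have h : IsUnit ((n : k) + 1) := (Nat.cast_add_one_ne_zero n).isUnit
  simpa using h.map (algebraMap k A)

theorem taylorSeries_add (d : Derivation k A A) (a b : A) :
    taylorSeries d (a + b) = taylorSeries d a + taylorSeries d b := by
  ext n
  simp [taylorSeries, mul_add]

theorem taylorSeries_algebraMap (d : Derivation k A A) (c : k) :
    taylorSeries d (algebraMap k A c) = algebraMap k A⟦X⟧ c := by
  ext n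
  rw [IsScalarTower.algebraMap_apply k A A⟦X⟧]
  change _ = coeff n (C (algebraMap k A c))
  cases n with
  | zero => simp [taylorSeries]
  | succ n => simp [taylorSeries]

variable [CharZero k]

theorem derivative_taylorSeries (d : Derivation k A A) (a : A) :
    derivative A (taylorSeries d a) = taylorSeries d (d a) := by
  ext n
  have h : (((n + 1).factorial : k))⁻¹ * (n + 1) = (n.factorial : k)⁻¹ := by
    have h1 : (n.factorial : k) ≠ 0 := Nat.cast_ne_zero.2 n.factorial_ne_zero
    have h2 : (n : k) + 1 ≠ 0 := Nat.cast_add_one_ne_zero n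
    rw [Nat.factorial_succ]
    push_cast
    field_simp
  rw [coeff_derivative, taylorSeries, taylorSeries, coeff_mk, coeff_mk,
    Function.iterate_succ_apply, ← h, map_mul]
  simp
  ring

/-- Differentiation lowers the degree: both sides satisfy the Leibniz rule, so coefficient `n + 1`
of the identity for `a, b`, multiplied by the unit `n + 1`, is coefficient `n` of the identities for
`a, d b` and `b, d a`. -/
theorem taylorSeries_mul (d : Derivation k A A) (a b : A) :
    taylorSeries d (a * b) = taylorSeries d a * taylorSeries d b := by
  ext n
  induction n generalizing a b with
  | zero => simp [taylorSeries]
  | succ n ih =>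
    apply (isUnit_natCast_succ k A n).mul_right_cancel
    rw [← coeff_derivative, ← coeff_derivative, derivative_taylorSeries, Derivation.leibniz,
      Derivation.leibniz, derivative_taylorSeries, derivative_taylorSeries, taylorSeries_add,
      map_add, map_add, smul_eq_mul, smul_eq_mul, smul_eq_mul, smul_eq_mul, ih, ih]

/-- The algebra map `a ↦ ∑ dⁿ(a) zⁿ / n!`. -/
def taylorHom (d : Derivation k A A) : A →ₐ[k] A⟦X⟧ :=
  AlgHom.mk' (RingHom.mk' ⟨⟨taylorSeries d, by simpa using taylorSeries_algebraMap d 1⟩,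
    taylorSeries_mul d⟩ (taylorSeries_add d)) fun c a => by
    change taylorSeries d (c • a) = c • taylorSeries d a
    rw [Algebra.smul_def, taylorSeries_mul, taylorSeries_algebraMap, ← Algebra.smul_def]

/-- The jet `a ↦ ∑ x(dⁿ(a)) zⁿ / n!` at the point `x`. -/
def taylorAt (d : Derivation k A A) (x : A →ₐ[k] R) : A →ₐ[k] R⟦X⟧ :=
  (PowerSeries.mapAlgHom x).comp (taylorHom d)

theorem taylorAt_apply (d : Derivation k A A) (x : A →ₐ[k] R) (a : A) :
    taylorAt d x a = PowerSeries.map x.toRingHom (taylorSeries d a) := rfl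

theorem constantCoeff_taylorAt (d : Derivation k A A) (x : A →ₐ[k] R) (a : A) :
    constantCoeff (taylorAt d x a) = x a := by
  rw [taylorAt_apply, ← coeff_zero_eq_constantCoeff_apply, coeff_map]
  simp [taylorSeries]

theorem taylorAt_coordinate (d : Derivation k A A) (x : A →ₐ[k] R) {t : A} (h : d t = 1) :
    taylorAt d x t = C (x t) + X := by
  rw [taylorAt_apply]
  ext n
  rw [coeff_map]
  rcases n with - | - | n
  · simp [taylorSeries]
  · simp [taylorSeries, h]
  · simp [taylorSeries, h, coeff_X]

end Taylor

/-! ### Completions isomorphic to a power series ring -/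

section Completion

variable {R B : Type u} [CommRing R] [CommRing B] [Algebra R B] {J : Ideal B}
  {T : B →ₐ[R] R⟦X⟧}

theorem eq_of_forall_sub_mem_maxIdeal_pow {f g : R⟦X⟧} (h : ∀ n, f - g ∈ maxIdeal R ^ n) :
    f = g := by
  ext n
  have := mem_maxIdeal_pow_iff.1 (h (n + 1)) n n.lt_succ_self
  rwa [map_sub, sub_eq_zero] at this

variable (T) in
/-- The extension of `T` to the `J`-adic completion, as a function. -/
def completionFun (c : AdicCompletion J B) : R⟦X⟧ :=
  PowerSeries.mk fun n => coeff n (T (Function.surjInv Ideal.Quotient.mk_surjective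
    (AdicCompletion.evalₐ J (n + 1) c)))

/-- The arbitrary representatives in `completionFun` are harmless: coefficient `m` is read off at
level `m + 1`, and two representatives at that level differ by an element of `J ^ (m + 1)`, whose
image has no terms of degree at most `m`. All algebraic properties of the extension are deduced from
this approximation. -/
theorem completionFun_sub_mem (hT : ∀ n b, T b ∈ maxIdeal R ^ n ↔ b ∈ J ^ n)
    (c : AdicCompletion J B) (n : ℕ) (b : B)
    (h : AdicCompletion.evalₐ J n c = Ideal.Quotient.mk _ b) :
    completionFun T c - T b ∈ maxIdeal R ^ n := by
  refine mem_maxIdeal_pow_iff.2 fun m hm => ?_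
  rw [map_sub, completionFun, coeff_mk, ← map_sub, ← map_sub]
  refine mem_maxIdeal_pow_iff.1 ((hT (m + 1) _).2 ?_) m m.lt_succ_self
  rw [← Ideal.Quotient.eq, Function.surjInv_eq Ideal.Quotient.mk_surjective]
  obtain ⟨s, rfl⟩ := AdicCompletion.mk_surjective J B c
  rw [AdicCompletion.evalₐ_mk, Ideal.Quotient.eq] at h
  rw [AdicCompletion.evalₐ_mk, ← AdicCompletion.Ideal.mk_eq_mk J hm s, Ideal.Quotient.eq]
  exact Ideal.pow_le_pow_right hm h

theorem exists_evalₐ_eq (c : AdicCompletion J B) (n : ℕ) :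
    ∃ b, AdicCompletion.evalₐ J n c = Ideal.Quotient.mk _ b := by
  obtain ⟨b, hb⟩ := Ideal.Quotient.mk_surjective (AdicCompletion.evalₐ J n c)
  exact ⟨b, hb.symm⟩

theorem completionFun_algebraMap (hT : ∀ n b, T b ∈ maxIdeal R ^ n ↔ b ∈ J ^ n) (b : B) :
    completionFun T (algebraMap B (AdicCompletion J B) b) = T b :=
  eq_of_forall_sub_mem_maxIdeal_pow fun n => completionFun_sub_mem hT _ n b (by
    rw [AdicCompletion.algebraMap_apply]; exact AdicCompletion.evalₐ_of J n b)

/-- The extension of `T` to the `J`-adic completion. -/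
def completionHom (hT : ∀ n b, T b ∈ maxIdeal R ^ n ↔ b ∈ J ^ n) :
    AdicCompletion J B →ₐ[R] R⟦X⟧ where
  toFun := completionFun T
  map_one' := by
    simpa using completionFun_algebraMap hT (1 : B)
  map_zero' := by
    simpa using completionFun_algebraMap hT (0 : B)
  map_mul' c c' := eq_of_forall_sub_mem_maxIdeal_pow fun n => by
    obtain ⟨b, hb⟩ := exists_evalₐ_eq c n
    obtain ⟨b', hb'⟩ := exists_evalₐ_eq c' n
    have h := completionFun_sub_mem hT (c * c') n (b * b') (by rw [map_mul, hb, hb', map_mul])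
    have h1 := completionFun_sub_mem hT c n b hb
    have h2 := completionFun_sub_mem hT c' n b' hb'
    rw [show completionFun T (c * c') - completionFun T c * completionFun T c' =
      (completionFun T (c * c') - T (b * b')) - ((completionFun T c - T b) * completionFun T c' +
        T b * (completionFun T c' - T b')) by rw [map_mul]; ring]
    exact Ideal.sub_mem _ h (Ideal.add_mem _ (Ideal.mul_mem_right _ _ h1)
      (Ideal.mul_mem_left _ _ h2))
  map_add' c c' := eq_of_forall_sub_mem_maxIdeal_pow fun n => by
    obtain ⟨b, hb⟩ := exists_evalₐ_eq c n
    obtain ⟨b', hb'⟩ := exists_evalₐ_eq c' n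
    have h := completionFun_sub_mem hT (c + c') n (b + b') (by rw [map_add, hb, hb', map_add])
    have h1 := completionFun_sub_mem hT c n b hb
    have h2 := completionFun_sub_mem hT c' n b' hb'
    rw [show completionFun T (c + c') - (completionFun T c + completionFun T c') =
      (completionFun T (c + c') - T (b + b')) - ((completionFun T c - T b) +
        (completionFun T c' - T b')) by rw [map_add]; ring]
    exact Ideal.sub_mem _ h (Ideal.add_mem _ h1 h2)
  commutes' r := by
    have := completionFun_algebraMap hT (algebraMap R B r)
    rwa [AlgHom.commutes] at this

/-- The hypothesis `hT` makes `B/Jⁿ → R[z]/zⁿ` injective, and `hs` makes it surjective. For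
surjectivity on the completion, approximations of `g` modulo `zⁿ` form a `J`-adic Cauchy sequence by
`hT`. -/
theorem completionHom_bijective (hT : ∀ n b, T b ∈ maxIdeal R ^ n ↔ b ∈ J ^ n)
    (hs : ∀ n g, ∃ b, T b - g ∈ maxIdeal R ^ n) : Function.Bijective (completionHom hT) := by
  constructor
  · rw [injective_iff_map_eq_zero]
    intro c hc
    apply AdicCompletion.ext_evalₐ
    intro n
    obtain ⟨b, hb⟩ := exists_evalₐ_eq c n
    have h := completionFun_sub_mem hT c n b hb
    change completionFun T c = 0 at hc
    rw [hc, zero_sub, neg_mem_iff, hT] at h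
    rw [hb, map_zero, Ideal.Quotient.eq_zero_iff_mem]
    exact h
  · intro g
    choose b hb using fun n => hs n g
    have hmem : ∀ m n, m ≤ n → b m - b n ∈ J ^ m := by
      intro m n hmn
      rw [← hT, map_sub, ← sub_sub_sub_cancel_right _ _ g]
      exact Ideal.sub_mem _ (hb m) (Ideal.pow_le_pow_right hmn (hb n))
    let c : AdicCompletion J B := AdicCompletion.mk J B
      ⟨b, fun {m n} hmn => by
        rw [SModEq.sub_mem]
        simpa using hmem m n hmn⟩
    refine ⟨c, eq_of_forall_sub_mem_maxIdeal_pow fun n => ?_⟩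
    have h := completionFun_sub_mem hT c n (b n) (AdicCompletion.evalₐ_mk J n _)
    have := Ideal.add_mem _ h (hb n)
    rwa [sub_add_sub_cancel] at this

/-- The isomorphism of the `J`-adic completion with `R[[z]]` extending `T`. -/
def completionEquiv (hT : ∀ n b, T b ∈ maxIdeal R ^ n ↔ b ∈ J ^ n)
    (hs : ∀ n g, ∃ b, T b - g ∈ maxIdeal R ^ n) : AdicCompletion J B ≃ₐ[R] R⟦X⟧ :=
  AlgEquiv.ofBijective _ (completionHom_bijective hT hs)

theorem completionEquiv_algebraMap (hT : ∀ n b, T b ∈ maxIdeal R ^ n ↔ b ∈ J ^ n)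
    (hs : ∀ n g, ∃ b, T b - g ∈ maxIdeal R ^ n) (b : B) :
    completionEquiv hT hs (algebraMap B (AdicCompletion J B) b) = T b :=
  completionFun_algebraMap hT b

/-- The equivalence matches the two filtrations exactly, which gives continuity in both directions.
-/
theorem evalₐ_eq_iff (hT : ∀ n b, T b ∈ maxIdeal R ^ n ↔ b ∈ J ^ n)
    (hs : ∀ n g, ∃ b, T b - g ∈ maxIdeal R ^ n) (c c' : AdicCompletion J B) (n : ℕ) :
    AdicCompletion.evalₐ J n c = AdicCompletion.evalₐ J n c' ↔
      completionEquiv hT hs c - completionEquiv hT hs c' ∈ maxIdeal R ^ n := by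
  obtain ⟨b, hb⟩ := exists_evalₐ_eq (c - c') n
  have h : completionEquiv hT hs (c - c') - T b ∈ maxIdeal R ^ n :=
    completionFun_sub_mem hT _ n b hb
  rw [← sub_eq_zero, ← map_sub, ← map_sub, hb, Ideal.Quotient.eq_zero_iff_mem, ← hT,
    ← sub_add_cancel (completionEquiv hT hs (c - c')) (T b), Submodule.add_mem_iff_right _ h]

theorem continuous_completionEquiv (hT : ∀ n b, T b ∈ maxIdeal R ^ n ↔ b ∈ J ^ n)
    (hs : ∀ n g, ∃ b, T b - g ∈ maxIdeal R ^ n) :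
    Continuous[⨅ n : ℕ, TopologicalSpace.induced (AdicCompletion.evalₐ J n) ⊥, zTop R]
      (completionEquiv hT hs) := by
  let : TopologicalSpace (AdicCompletion J B) :=
    ⨅ n : ℕ, TopologicalSpace.induced (AdicCompletion.evalₐ J n) ⊥
  let := zTop R
  refine continuous_iff_continuousAt.2 fun c => ?_
  rw [ContinuousAt, ((maxIdeal R).hasBasis_nhds_adic _).tendsto_right_iff]
  intro n _
  have ho : IsOpen {c' : AdicCompletion J B |
      AdicCompletion.evalₐ J n c' = AdicCompletion.evalₐ J n c} := by
    have hc : Continuous[_, ⊥] (AdicCompletion.evalₐ J n) :=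
      continuous_iInf_dom (i := n) continuous_induced_dom
    let : TopologicalSpace (B ⧸ J ^ n) := ⊥
    have : DiscreteTopology (B ⧸ J ^ n) := ⟨rfl⟩
    exact (isOpen_discrete {AdicCompletion.evalₐ J n c}).preimage hc
  filter_upwards [ho.mem_nhds rfl] with c' hc'
  exact ⟨_, (evalₐ_eq_iff hT hs c' c n).1 hc', by simp⟩

theorem continuous_completionEquiv_symm (hT : ∀ n b, T b ∈ maxIdeal R ^ n ↔ b ∈ J ^ n)
    (hs : ∀ n g, ∃ b, T b - g ∈ maxIdeal R ^ n) :
    Continuous[zTop R, ⨅ n : ℕ, TopologicalSpace.induced (AdicCompletion.evalₐ J n) ⊥]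
      (completionEquiv hT hs).symm := by
  let := zTop R
  refine continuous_iInf_rng.2 fun n => continuous_induced_rng.2 ?_
  let : TopologicalSpace (B ⧸ J ^ n) := ⊥
  have : DiscreteTopology (B ⧸ J ^ n) := ⟨rfl⟩
  refine continuous_iff_continuousAt.2 fun g => ?_
  rw [ContinuousAt, nhds_discrete (B ⧸ J ^ n), Filter.tendsto_pure]
  refine Filter.mem_of_superset (((maxIdeal R).hasBasis_nhds_adic g).mem_of_mem (i := n) trivial) ?_
  rintro _ ⟨h, hh, rfl⟩
  change AdicCompletion.evalₐ J n _ = AdicCompletion.evalₐ J n _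
  rw [evalₐ_eq_iff hT hs]
  simpa using hh

end Completion

/-! ### The isomorphisms `ρ^x_t` -/

section Rho

variable {k R A : Type u} [Field k] [CommRing R] [Algebra k R] [CommRing A] [Algebra k A]

/-- The element `t - x(t)` of `R ⊗ A`. -/
def localParam (x : A →ₐ[k] R) (a : A) : R ⊗[k] A := 1 ⊗ₜ[k] a - x a ⊗ₜ[k] 1

theorem mem_pointIdeal_iff {x : A →ₐ[k] R} {b : R ⊗[k] A} : b ∈ pointIdeal x ↔
    Algebra.TensorProduct.lift (AlgHom.id R R) x (fun _ _ => Commute.all _ _) b = 0 := Iff.rfl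

theorem localParam_mem (x : A →ₐ[k] R) (a : A) : localParam x a ∈ pointIdeal x := by
  rw [mem_pointIdeal_iff, localParam, map_sub]
  simp

/-- Modulo `J_x²` the map `a ↦ a - x(a)` is a derivation, the defect in the Leibniz rule being `-(a
- x(a))(b - x(b))`. Modulo `t - x(t)` it kills the coordinate, hence is zero. -/
theorem localParam_mem_sup {t : A} (ht : IsCoordinate k t) (x : A →ₐ[k] R) (a : A) :
    localParam x a ∈ Ideal.span {localParam x t} ⊔ pointIdeal x ^ 2 := by
  set I : Ideal (R ⊗[k] A) := Ideal.span {localParam x t} ⊔ pointIdeal x ^ 2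
  let : Module A (R ⊗[k] A ⧸ I) := Module.compHom _
    (Algebra.TensorProduct.includeRight : A →ₐ[k] R ⊗[k] A).toRingHom
  have hsmul : ∀ (a : A) (b : R ⊗[k] A),
      a • Ideal.Quotient.mk I b = Ideal.Quotient.mk I ((1 ⊗ₜ[k] a) * b) := fun _ _ => rfl
  have : IsScalarTower k A (R ⊗[k] A ⧸ I) := ⟨fun c a b => by
    obtain ⟨b, rfl⟩ := Ideal.Quotient.mk_surjective b
    rw [hsmul, hsmul, TensorProduct.tmul_smul, smul_mul_assoc]
    rfl⟩
  let d : Derivation k A (R ⊗[k] A ⧸ I) := Derivation.mk'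
    { toFun := fun a => Ideal.Quotient.mk I (localParam x a)
      map_add' := fun a b => by
        rw [← map_add, localParam, localParam, localParam, map_add, TensorProduct.tmul_add,
          TensorProduct.add_tmul, add_sub_add_comm]
      map_smul' := fun c a => by
        rw [localParam, localParam, map_smul, TensorProduct.tmul_smul, ← TensorProduct.smul_tmul',
          ← smul_sub]
        rfl }
    (fun a b => by
      change Ideal.Quotient.mk I (localParam x (a * b)) =
        a • Ideal.Quotient.mk I (localParam x b) + b • Ideal.Quotient.mk I (localParam x a)
      rw [hsmul, hsmul, ← map_add, Ideal.Quotient.eq]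
      have h1 : (1 : R) ⊗ₜ[k] (a * b) = (1 ⊗ₜ[k] a) * (1 ⊗ₜ[k] b) := by simp
      have h2 : x (a * b) ⊗ₜ[k] (1 : A) = (x a ⊗ₜ[k] 1) * (x b ⊗ₜ[k] 1) := by simp
      have : localParam x (a * b) - ((1 ⊗ₜ[k] a) * localParam x b +
          (1 ⊗ₜ[k] b) * localParam x a) = -(localParam x a * localParam x b) := by
        simp only [localParam, h1, h2]
        ring
      rw [this, neg_mem_iff]
      refine (le_sup_right : _ ≤ I) ?_
      rw [pow_two]
      exact Ideal.mul_mem_mul (localParam_mem x a) (localParam_mem x b))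
  have h := ht.derivation_eq_zero d (Ideal.Quotient.eq_zero_iff_mem.2
    ((le_sup_left : _ ≤ I) (Ideal.mem_span_singleton_self _))) a
  exact Ideal.Quotient.eq_zero_iff_mem.1 h

theorem pointIdeal_le_sup {t : A} (ht : IsCoordinate k t) (x : A →ₐ[k] R) :
    pointIdeal x ≤ Ideal.span {localParam x t} ⊔ pointIdeal x ^ 2 := by
  set I : Ideal (R ⊗[k] A) := Ideal.span {localParam x t} ⊔ pointIdeal x ^ 2
  have key : ∀ b : R ⊗[k] A, b - (Algebra.TensorProduct.lift (AlgHom.id R R) x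
      (fun _ _ => Commute.all _ _) b) ⊗ₜ[k] 1 ∈ I := by
    intro b
    induction b using TensorProduct.induction_on with
    | zero => simp
    | add b c hb hc =>
      rw [map_add, TensorProduct.add_tmul, add_sub_add_comm]
      exact I.add_mem hb hc
    | tmul r a =>
      have : r ⊗ₜ[k] a - (Algebra.TensorProduct.lift (AlgHom.id R R) x
          (fun _ _ => Commute.all _ _) (r ⊗ₜ[k] a)) ⊗ₜ[k] 1 =
          (r ⊗ₜ[k] 1) * localParam x a := by
        simp [localParam, mul_sub]
      rw [this]
      exact I.mul_mem_left _ (localParam_mem_sup ht x a)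
  intro b hb
  have := key b
  rwa [mem_pointIdeal_iff.1 hb, TensorProduct.zero_tmul, sub_zero] at this

/-- Since `J_x = (t - x(t)) + J_x²`, each graded piece `J_xⁿ/J_xⁿ⁺¹` is generated by `(t - x(t))ⁿ`.
-/
theorem pointIdeal_pow_le_sup {t : A} (ht : IsCoordinate k t) (x : A →ₐ[k] R) (n : ℕ) :
    pointIdeal x ^ n ≤ Ideal.span {localParam x t ^ n} ⊔ pointIdeal x ^ (n + 1) := by
  induction n with
  | zero => simp
  | succ n ih =>
    have h1 : Ideal.span {localParam x t} ≤ pointIdeal x :=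
      (Ideal.span_singleton_le_iff_mem _).2 (localParam_mem x t)
    have hJ := pointIdeal_le_sup ht x
    rw [← Ideal.span_singleton_pow] at ih ⊢
    set J := pointIdeal x
    set τ := Ideal.span {localParam x t}
    calc J ^ (n + 1) = J ^ n * J := pow_succ _ _
      _ ≤ (τ ^ n ⊔ J ^ (n + 1)) * J := Ideal.mul_mono_left ih
      _ = τ ^ n * J ⊔ J ^ (n + 2) := by rw [Ideal.sup_mul, ← pow_succ]
      _ ≤ τ ^ n * (τ ⊔ J ^ 2) ⊔ J ^ (n + 2) := sup_le_sup_right (Ideal.mul_mono_right hJ) _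
      _ = τ ^ (n + 1) ⊔ τ ^ n * J ^ 2 ⊔ J ^ (n + 2) := by rw [Ideal.mul_sup, ← pow_succ]
      _ ≤ τ ^ (n + 1) ⊔ J ^ (n + 1 + 1) := by
        refine sup_le (sup_le le_sup_left (le_trans ?_ le_sup_right)) le_sup_right
        calc τ ^ n * J ^ 2 ≤ J ^ n * J ^ 2 := Ideal.mul_mono_left (Ideal.pow_right_mono h1 n)
          _ = J ^ (n + 1 + 1) := (pow_add _ _ _).symm

/-- The extension `R ⊗ A → R[[z]]` of a jet `A → R[[z]]`. -/
def jetLift (φ : A →ₐ[k] R⟦X⟧) : R ⊗[k] A →ₐ[R] R⟦X⟧ :=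
  Algebra.TensorProduct.lift (Algebra.ofId R R⟦X⟧) φ fun _ _ => Commute.all _ _

theorem jetLift_tmul (φ : A →ₐ[k] R⟦X⟧) (r : R) (a : A) :
    jetLift φ (r ⊗ₜ[k] a) = C r * φ a :=
  Algebra.TensorProduct.lift_tmul ..

theorem constantCoeff_jetLift {φ : A →ₐ[k] R⟦X⟧} {x : A →ₐ[k] R}
    (h : ∀ a, constantCoeff (φ a) = x a) (b : R ⊗[k] A) :
    constantCoeff (jetLift φ b) =
      Algebra.TensorProduct.lift (AlgHom.id R R) x (fun _ _ => Commute.all _ _) b := by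
  induction b using TensorProduct.induction_on with
  | zero => simp
  | add b c hb hc => rw [map_add, map_add, hb, hc, map_add]
  | tmul r a => simp [jetLift_tmul, h]

/-- Injectivity on graded pieces. An element of `J_xⁿ` is `(t - x(t))ⁿ c` modulo `J_xⁿ⁺¹`, with
image `zⁿ · jetLift φ c` modulo `zⁿ⁺¹`. If that image vanishes, the constant term of `jetLift φ c`
is zero, so `c` lies in `J_x`. No regularity of `t - x(t)` is needed. -/
theorem jetLift_mem_pow_iff {t : A} (ht : IsCoordinate k t) {φ : A →ₐ[k] R⟦X⟧} {x : A →ₐ[k] R}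
    (h : ∀ a, constantCoeff (φ a) = x a) (hφ : φ t = C (x t) + X) (n : ℕ) (b : R ⊗[k] A) :
    jetLift φ b ∈ maxIdeal R ^ n ↔ b ∈ pointIdeal x ^ n := by
  have hmem : ∀ b, jetLift φ b ∈ maxIdeal R ↔ b ∈ pointIdeal x := fun b => by
    rw [mem_maxIdeal_iff, constantCoeff_jetLift h, mem_pointIdeal_iff]
  have hpow : ∀ n, ∀ b ∈ pointIdeal x ^ n, jetLift φ b ∈ maxIdeal R ^ n := by
    intro n b hb
    have h1 : (pointIdeal x ^ n).map (jetLift φ).toRingHom ≤ maxIdeal R ^ n := by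
      rw [Ideal.map_pow]
      refine Ideal.pow_right_mono ?_ n
      rw [Ideal.map_le_iff_le_comap]
      exact fun b hb => (hmem b).2 hb
    exact h1 (Ideal.mem_map_of_mem (jetLift φ).toRingHom hb)
  have hτ : jetLift φ (localParam x t) = X := by
    rw [localParam, map_sub, jetLift_tmul, jetLift_tmul, hφ]
    simp
  refine ⟨?_, hpow n b⟩
  induction n generalizing b with
  | zero => simp
  | succ n ih =>
    intro hb
    obtain ⟨c', hc', e, he, rfl⟩ := Submodule.mem_sup.1 (pointIdeal_pow_le_sup ht x n
      (ih b (Ideal.pow_le_pow_right n.le_succ hb)))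
    obtain ⟨c, rfl⟩ := Ideal.mem_span_singleton.1 hc'
    refine Ideal.add_mem _ ?_ he
    rw [map_add, Submodule.add_mem_iff_left _ (hpow _ e he), map_mul, map_pow, hτ] at hb
    have h0 := mem_maxIdeal_pow_iff.1 hb n n.lt_succ_self
    have h1 : coeff n (X ^ n * jetLift φ c) = constantCoeff (jetLift φ c) := by
      simpa using coeff_X_pow_mul (jetLift φ c) n 0
    rw [h1, ← mem_maxIdeal_iff, hmem] at h0
    rw [pow_succ]
    exact Ideal.mul_mem_mul (Ideal.pow_mem_pow (localParam_mem x t) n) h0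

theorem exists_jetLift_sub_mem {t : A} {φ : A →ₐ[k] R⟦X⟧} {x : A →ₐ[k] R}
    (hφ : φ t = C (x t) + X) (n : ℕ) (g : R⟦X⟧) : ∃ b, jetLift φ b - g ∈ maxIdeal R ^ n := by
  -- As `t - x(t)` goes to `z`, the truncation of `g` evaluated at it goes to that truncation.
  refine ⟨Polynomial.aeval (localParam x t) (trunc n g), ?_⟩
  have hτ : jetLift φ (localParam x t) = X := by
    rw [localParam, map_sub, jetLift_tmul, jetLift_tmul, hφ]
    simp
  have : ∀ q : Polynomial R, Polynomial.aeval (X : R⟦X⟧) q = (q : R⟦X⟧) := by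
    intro q
    have : (Polynomial.aeval X : Polynomial R →ₐ[R] R⟦X⟧) =
        Polynomial.coeToPowerSeries.algHom R := by
      apply Polynomial.algHom_ext
      simp
    simpa using congrArg (fun f => f q) this
  rw [← Polynomial.aeval_algHom_apply, hτ, this]
  refine mem_maxIdeal_pow_iff.2 fun m hm => ?_
  simp [coeff_trunc, hm]

/-- A jet which sends a coordinate `t` to `x(t) + z` extends to an isomorphism `𝒯_x R ≃ R[[z]]`. -/
theorem exists_formalIso {t : A} (ht : IsCoordinate k t) {φ : A →ₐ[k] R⟦X⟧} {x : A →ₐ[k] R}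
    (h : ∀ a, constantCoeff (φ a) = x a) (hφ : φ t = C (x t) + X) :
    ∃ ψ : FormalIso x, ψ.IsRho t := by
  have hT := jetLift_mem_pow_iff ht h hφ
  have hs := exists_jetLift_sub_mem hφ
  refine ⟨⟨completionEquiv hT hs, continuous_completionEquiv hT hs,
    continuous_completionEquiv_symm hT hs, fun a ha => ?_⟩, ?_⟩
  · rw [completionEquiv_algebraMap]
    have := (hT 1 a).2 (by simpa using ha)
    rwa [pow_one] at this
  · change (completionEquiv hT hs).symm X = _
    rw [AlgEquiv.symm_apply_eq, completionEquiv_algebraMap, map_sub, jetLift_tmul, jetLift_tmul, hφ]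
    simp

variable {x : A →ₐ[k] R}

theorem FormalIso.apply_algebraMap_tmul (φ : FormalIso x) (r : R) (a : A) :
    φ.1 (algebraMap (R ⊗[k] A) (PtCompletion x) (r ⊗ₜ[k] a)) = C r * φ.toHom a := by
  have h : r ⊗ₜ[k] a = r • (1 ⊗ₜ[k] a : R ⊗[k] A) := by simp [TensorProduct.smul_tmul']
  rw [h, ← algebraMap_smul (R ⊗[k] A) r, smul_eq_mul, map_mul,
    ← IsScalarTower.algebraMap_apply R (R ⊗[k] A) (PtCompletion x), map_mul, AlgEquiv.commutes]
  rfl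

theorem FormalIso.apply_localParam (φ : FormalIso x) (a : A) :
    φ.1 (algebraMap (R ⊗[k] A) (PtCompletion x) (localParam x a)) = φ.toHom a - C (x a) := by
  rw [localParam, map_sub, map_sub, apply_algebraMap_tmul, apply_algebraMap_tmul]
  simp

theorem FormalIso.constantCoeff_toHom (φ : FormalIso x) (a : A) :
    constantCoeff (φ.toHom a) = x a := by
  have := φ.2.2.2 _ (localParam_mem x a)
  rwa [apply_localParam, mem_maxIdeal_iff, map_sub, constantCoeff_C, sub_eq_zero] at this

theorem FormalIso.isRho_iff {φ : FormalIso x} {t : A} : φ.IsRho t ↔ φ.toHom t = C (x t) + X := by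
  have h : φ.IsRho t ↔ X = φ.toHom t - C (x t) := by
    rw [← apply_localParam, ← AlgEquiv.symm_apply_eq]
    rfl
  rw [h, eq_sub_iff_add_eq', eq_comm]

theorem FormalIso.toHom_act (ρ : AutPlus R) (φ : FormalIso x) (a : A) :
    (FormalIso.act ρ φ).toHom a = ρ.1 (φ.toHom a) := rfl

/-- Take `ρ = φ ∘ ψ⁻¹`. It preserves `zR[[z]]` because `ψ⁻¹(z) = t - x(t)` lies in `J_x`, which is
where `hψ` enters. -/
theorem FormalIso.exists_act_eq (φ ψ : FormalIso x) {t : A} (hψ : ψ.IsRho t) :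
    ∃ ρ : AutPlus R, FormalIso.act ρ ψ = φ := by
  let := zTop R
  let := completionTop x
  refine ⟨⟨ψ.1.symm.trans φ.1, φ.2.1.comp ψ.2.2.1, ψ.2.1.comp φ.2.2.1, fun g hg => ?_⟩, ?_⟩
  · obtain ⟨h, rfl⟩ := Ideal.mem_span_singleton.1 hg
    rw [map_mul]
    refine Ideal.mul_mem_right _ _ ?_
    change φ.1 (ψ.1.symm X) ∈ _
    rw [hψ]
    exact φ.2.2.2 _ (localParam_mem x t)
  · apply Subtype.ext
    ext1 c
    change φ.1 (ψ.1.symm (ψ.1 c)) = φ.1 c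
    rw [AlgEquiv.symm_apply_apply]

theorem FormalIso.ext_coordinate {φ φ' ψ : FormalIso x} {t : A} (hψ : ψ.IsRho t)
    (h : φ.toHom t = φ'.toHom t) : φ = φ' := by
  obtain ⟨ρ, rfl⟩ := φ.exists_act_eq ψ hψ
  obtain ⟨ρ', rfl⟩ := φ'.exists_act_eq ψ hψ
  rw [toHom_act, toHom_act, isRho_iff.1 hψ, map_add, map_add] at h
  have h1 : ρ.1 (C (x t)) = C (x t) := ρ.1.commutes _
  have h2 : ρ'.1 (C (x t)) = C (x t) := ρ'.1.commutes _
  rw [h1, h2, add_right_inj] at h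
  rw [AutPlus.ext_X h]

theorem existsUnique_isRho [CharZero k] {t : A} (ht : IsCoordinate k t) {d : Derivation k A A}
    (hd : d t = 1) (x : A →ₐ[k] R) : ∃! φ : FormalIso x, φ.IsRho t := by
  obtain ⟨φ, hφ⟩ := exists_formalIso ht (constantCoeff_taylorAt d x) (taylorAt_coordinate d x hd)
  exact ⟨φ, hφ, fun φ' hφ' => FormalIso.ext_coordinate hφ
    ((FormalIso.isRho_iff.1 hφ').trans (FormalIso.isRho_iff.1 hφ).symm)⟩

/-- Identifies the jet of `ρ^x_t` with an explicit formula. Naturality in `R` and the change of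
coordinates are both read off from it. -/
theorem FormalIso.IsRho.toHom_eq [CharZero k] {t : A} (ht : IsCoordinate k t)
    {d : Derivation k A A} (hd : d t = 1) {φ : FormalIso x} (hφ : φ.IsRho t) :
    φ.toHom = taylorAt d x :=
  ht.jet_ext (fun a => by rw [φ.constantCoeff_toHom, constantCoeff_taylorAt])
    (by rw [isRho_iff.1 hφ, taylorAt_coordinate d x hd])

/-- The jets at `x` with an invertible derivative of `t` are obtained from isomorphisms
`𝒯_x R ≃ R[[z]]`. -/
theorem FormalIso.exists_act_toHom_eq {t : A} (ht : IsCoordinate k t)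
    {φ : FormalIso x} (hφ : φ.IsRho t) {ψ : A →ₐ[k] R⟦X⟧} (h0 : ∀ a, constantCoeff (ψ a) = x a)
    (h1 : IsUnit (coeff 1 (ψ t))) : ∃ ρ : AutPlus R, (FormalIso.act ρ φ).toHom = ψ := by
  obtain ⟨ρ, hρ⟩ := AutPlus.exists_apply_X (ψ t - C (x t)) (by simp [h0]) (by simpa using h1)
  refine ⟨ρ, ht.jet_ext (fun a => ?_) ?_⟩
  · rw [constantCoeff_toHom, h0]
  · have hC : ρ.1 (C (x t)) = C (x t) := ρ.1.commutes _
    rw [toHom_act, isRho_iff.1 hφ, map_add, hC, hρ, add_sub_cancel]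

theorem FormalIso.isUnit_coeff_one_toHom {φ ψ : FormalIso x} {t : A} (hψ : ψ.IsRho t) :
    IsUnit (coeff 1 (φ.toHom t)) := by
  obtain ⟨ρ, rfl⟩ := φ.exists_act_eq ψ hψ
  rw [toHom_act, AutPlus.coeff_one_apply, isRho_iff.1 hψ]
  simpa using AutPlus.isUnit_coeff_one ρ

/-- The change of coordinates. -/
theorem FormalIso.toHom_eq_changeCoordinate [CharZero k] {t s : A} (ht : IsCoordinate k t)
    (hs : IsCoordinate k s) {d : Derivation k A A} (hd : d t = 1) {u : AutPlus A}
    (hu : u.1 X = PowerSeries.mk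
      (fun n => if n = 0 then 0 else algebraMap k A (n.factorial : k)⁻¹ * d^[n] s))
    {φ φ' : FormalIso x} (hφ : φ.IsRho t) (hφ' : φ'.IsRho s) :
    φ.toHom = (FormalIso.act (AutPlus.map x.toRingHom u) φ').toHom := by
  refine hs.jet_ext (fun a => by rw [constantCoeff_toHom, constantCoeff_toHom]) ?_
  -- It remains to compare the values at `s`. On the left this is the Taylor series of `s` at `x`,
  -- that is, `x(s)` plus the image of `u(z)`; on the right it is the image of `u` applied to `x(s)
  -- + z`.
  have hC : (AutPlus.map x.toRingHom u).1 (C (x s)) = C (x s) :=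
    (AutPlus.map x.toRingHom u).1.commutes _
  rw [toHom_act, isRho_iff.1 hφ', map_add, hC, AutPlus.map_apply_X, hu, hφ.toHom_eq ht hd,
    taylorAt_apply]
  ext n
  rw [map_add, coeff_map, coeff_map]
  rcases n with - | n
  · simp [taylorSeries]
  · simp [taylorSeries]

end Rho

/-! ### Locally cyclic modules -/

section LocallyCyclic

/-- The `A`-module `M` is generated by one element, locally on `Spec A`. -/
def LocallyCyclic (A M : Type u) [CommRing A] [AddCommGroup M] [Module A M] : Prop :=
  ∃ s : Set A, Ideal.span s = ⊤ ∧ ∀ g ∈ s, ∃ e : M, ∀ m : M, ∃ (n : ℕ) (a : A), g ^ n • m = a • e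

variable {A B M : Type u} [CommRing A] [CommRing B] [Algebra A B] [AddCommGroup M] [Module A M]

/-- For multiples `v = a e` and `w = a' e` of one element both sides are `a a' L(e) e`. The general
case reduces to this after multiplication by powers of elements generating the unit ideal. -/
theorem LocallyCyclic.apply_smul_comm (hM : LocallyCyclic A M) (L : B ⊗[A] M →ₗ[B] B)
    (v w : B ⊗[A] M) : L v • w = L w • v := by
  have key : ∀ m m' : M, L (1 ⊗ₜ m) • (1 ⊗ₜ[A] m' : B ⊗[A] M) = L (1 ⊗ₜ m') • (1 ⊗ₜ[A] m) := by
    intro m m'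
    obtain ⟨s, hs, h⟩ := hM
    rw [← sub_eq_zero, ← Submodule.mem_bot A]
    refine Submodule.mem_of_span_eq_top_of_smul_pow_mem _ s hs _ fun g => ?_
    obtain ⟨e, he⟩ := h g.1 g.2
    obtain ⟨n, a, ha⟩ := he m
    obtain ⟨n', a', ha'⟩ := he m'
    have hL : ∀ (c : A) (m : M), L (1 ⊗ₜ[A] (c • m)) = algebraMap A B c * L (1 ⊗ₜ m) := by
      intro c m
      rw [← smul_eq_mul, ← map_smul, algebraMap_smul, TensorProduct.tmul_smul]
    have ht : ∀ (c : A) (m : M), (1 ⊗ₜ[A] (c • m) : B ⊗[A] M) = algebraMap A B c • (1 ⊗ₜ m) := by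
      intro c m
      rw [algebraMap_smul, TensorProduct.tmul_smul]
    have hg : ∀ (c : A) (z : B ⊗[A] M), algebraMap A B c • z = c • z := algebraMap_smul B
    refine ⟨n + n', ?_⟩
    rw [Submodule.mem_bot, smul_sub, sub_eq_zero, ← hg, ← hg]
    have e1 : algebraMap A B (g.1 ^ (n + n')) • L (1 ⊗ₜ m) • (1 ⊗ₜ[A] m' : B ⊗[A] M) =
        L (1 ⊗ₜ[A] (g.1 ^ n • m)) • (1 ⊗ₜ[A] (g.1 ^ n' • m')) := by
      rw [hL, ht, smul_smul, smul_smul, pow_add, map_mul]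
      ring_nf
    have e2 : algebraMap A B (g.1 ^ (n + n')) • L (1 ⊗ₜ m') • (1 ⊗ₜ[A] m : B ⊗[A] M) =
        L (1 ⊗ₜ[A] (g.1 ^ n' • m')) • (1 ⊗ₜ[A] (g.1 ^ n • m)) := by
      rw [hL, ht, smul_smul, smul_smul, pow_add, map_mul]
      ring_nf
    rw [e1, e2, ha, ha', hL, hL, ht, ht, smul_smul, smul_smul]
    ring_nf
  have hb : ∀ (b : B) (m : M), (b ⊗ₜ[A] m : B ⊗[A] M) = b • (1 ⊗ₜ m) := fun b m => by
    rw [TensorProduct.smul_tmul', smul_eq_mul, mul_one]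
  induction v using TensorProduct.induction_on with
  | zero => simp
  | add v v' hv hv' => rw [map_add, add_smul, hv, hv', smul_add]
  | tmul b m =>
    induction w using TensorProduct.induction_on with
    | zero => simp
    | add w w' hw hw' => rw [map_add, add_smul, ← hw, ← hw', smul_add]
    | tmul b' m' =>
      have hs : ∀ (c c' l : B) (z : B ⊗[A] M), (c • l) • c' • z = (c * c') • l • z := by
        intro c c' l z
        simp only [smul_smul, smul_eq_mul]
        ring_nf
      rw [hb, hb b', map_smul, map_smul, hs, hs, key, mul_comm]

/-- If `L v = 1` and `L w = 0`, then `w = L(v) w = L(w) v = 0`. Projectivity of the module plays no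
role. -/
theorem LocallyCyclic.bijective_of_surjective (hM : LocallyCyclic A M) {L : B ⊗[A] M →ₗ[B] B}
    (h : Function.Surjective L) : Function.Bijective L := by
  refine ⟨(injective_iff_map_eq_zero L).2 fun w hw => ?_, h⟩
  obtain ⟨v, hv⟩ := h 1
  have := hM.apply_smul_comm L v w
  rwa [hv, hw, one_smul, zero_smul] at this

end LocallyCyclic

/-! ### Differentials of truncated power series rings -/

section TruncOmega

variable (R : Type u) [CommRing R]

/-- The action of `R[z]/zⁿ⁺¹` on its quotient `R[z]/zⁿ`. -/
abbrev truncModule (n : ℕ) : Module (TruncPS R (n + 1)) (TruncPS R n) :=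
  Module.compHom _ (Ideal.Quotient.factor (Ideal.pow_le_pow_right n.le_succ :
    maxIdeal R ^ (n + 1) ≤ maxIdeal R ^ n))

attribute [local instance] truncModule

instance truncModule_isScalarTower (n : ℕ) :
    IsScalarTower R (TruncPS R (n + 1)) (TruncPS R n) := ⟨fun r f g => by
  obtain ⟨f, rfl⟩ := Ideal.Quotient.mk_surjective f
  obtain ⟨g, rfl⟩ := Ideal.Quotient.mk_surjective g
  change Ideal.Quotient.mk (maxIdeal R ^ n) (r • f * g) = Ideal.Quotient.mk _ (r • (f * g))
  rw [smul_mul_assoc]⟩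

theorem derivative_mem_maxIdeal_pow {n : ℕ} {f : R⟦X⟧} (hf : f ∈ maxIdeal R ^ (n + 1)) :
    derivative R f ∈ maxIdeal R ^ n := by
  refine mem_maxIdeal_pow_iff.2 fun m hm => ?_
  rw [coeff_derivative, mem_maxIdeal_pow_iff.1 hf (m + 1) (by omega), zero_mul]

theorem constantCoeff_derivative (f : R⟦X⟧) : constantCoeff (derivative R f) = coeff 1 f := by
  rw [← coeff_zero_eq_constantCoeff_apply, coeff_derivative]
  simp

/-- The derivation `d/dz : R[z]/zⁿ⁺¹ → R[z]/zⁿ`. -/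
def truncDerivation (n : ℕ) : Derivation R (TruncPS R (n + 1)) (TruncPS R n) :=
  Derivation.mk'
    (Submodule.liftQ ((maxIdeal R ^ (n + 1)).restrictScalars R)
      ((Ideal.Quotient.mkₐ R (maxIdeal R ^ n)).toLinearMap ∘ₗ (derivative R).toLinearMap)
      (fun f hf => Ideal.Quotient.eq_zero_iff_mem.2 (derivative_mem_maxIdeal_pow R hf)))
    (fun f g => by
      obtain ⟨f, rfl⟩ := Ideal.Quotient.mk_surjective f
      obtain ⟨g, rfl⟩ := Ideal.Quotient.mk_surjective g
      change Ideal.Quotient.mk (maxIdeal R ^ n) (derivative R (f * g)) = _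
      rw [Derivation.leibniz, map_add]
      rfl)

theorem truncDerivation_mk (n : ℕ) (f : R⟦X⟧) :
    truncDerivation R n (Ideal.Quotient.mk _ f) = Ideal.Quotient.mk _ (derivative R f) := rfl

/-- The map `Ω¹_{(R[z]/zⁿ⁺¹)/R} → R[z]/zⁿ`, `dz ↦ 1`. -/
def truncOmegaMap (n : ℕ) : Ω[TruncPS R (n + 1)⁄R] →ₗ[TruncPS R (n + 1)] TruncPS R n :=
  (truncDerivation R n).liftKaehlerDifferential

theorem truncOmegaMap_smul_D (n : ℕ) (f g : R⟦X⟧) :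
    truncOmegaMap R n (Ideal.Quotient.mk (maxIdeal R ^ (n + 1)) f •
      D R (TruncPS R (n + 1)) (Ideal.Quotient.mk _ g)) =
      Ideal.Quotient.mk _ (f * derivative R g) := by
  rw [map_smul, truncOmegaMap, Derivation.liftKaehlerDifferential_comp_D, truncDerivation_mk]
  rfl

theorem exists_smul_D_eq (n : ℕ) (w : Ω[TruncPS R n⁄R]) : ∃ f : R⟦X⟧,
    w = Ideal.Quotient.mk (maxIdeal R ^ n) f • D R (TruncPS R n) (Ideal.Quotient.mk _ X) := by
  suffices h : w ∈ Submodule.span (TruncPS R n) {D R (TruncPS R n) (Ideal.Quotient.mk _ X)} by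
    obtain ⟨f, rfl⟩ := Submodule.mem_span_singleton.1 h
    obtain ⟨f, rfl⟩ := Ideal.Quotient.mk_surjective f
    exact ⟨f, rfl⟩
  suffices h : ⊤ ≤ Submodule.span (TruncPS R n) {D R (TruncPS R n) (Ideal.Quotient.mk _ X)} from
    h trivial
  rw [← KaehlerDifferential.span_range_derivation, Submodule.span_le]
  rintro _ ⟨g, rfl⟩
  obtain ⟨g, rfl⟩ := Ideal.Quotient.mk_surjective g
  have hg : Ideal.Quotient.mk (maxIdeal R ^ n) g =
      Polynomial.aeval (Ideal.Quotient.mk (maxIdeal R ^ n) X) (trunc n g) := by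
    have h1 : (Polynomial.aeval (Ideal.Quotient.mk (maxIdeal R ^ n) X) :
        Polynomial R →ₐ[R] TruncPS R n) = (Ideal.Quotient.mkₐ R (maxIdeal R ^ n)).comp
          (Polynomial.coeToPowerSeries.algHom R) := by
      apply Polynomial.algHom_ext
      simp
    rw [h1]
    change _ = Ideal.Quotient.mk _ (Polynomial.coeToPowerSeries.algHom R (trunc n g))
    rw [Ideal.Quotient.eq]
    refine mem_maxIdeal_pow_iff.2 fun m hm => ?_
    simp [coeff_trunc, hm]
  rw [hg, SetLike.mem_coe, Derivation.map_aeval]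
  exact Submodule.smul_mem _ _ (Submodule.mem_span_singleton_self _)

/-- Differentiating `zⁿ⁺¹ = 0` gives `(n + 1) zⁿ dz = 0`, and `n + 1` is invertible in
characteristic 0. Hence the differentials of `R[z]/zⁿ⁺¹` are only `R[z]/zⁿ · dz`, one degree less
than the ring. -/
theorem smul_D_eq_zero (k : Type u) [Field k] [CharZero k] [Algebra k R] (n : ℕ) {f : R⟦X⟧}
    (hf : f ∈ maxIdeal R ^ n) :
    Ideal.Quotient.mk (maxIdeal R ^ (n + 1)) f •
      D R (TruncPS R (n + 1)) (Ideal.Quotient.mk _ X) = 0 := by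
  rw [Ideal.span_singleton_pow, Ideal.mem_span_singleton] at hf
  obtain ⟨h, rfl⟩ := hf
  have h0 : (Ideal.Quotient.mk (maxIdeal R ^ (n + 1)) X) ^ (n + 1) = 0 := by
    rw [← map_pow, Ideal.Quotient.eq_zero_iff_mem]
    exact Ideal.pow_mem_pow (Ideal.mem_span_singleton_self _) _
  have h1 := (D R (TruncPS R (n + 1))).leibniz_pow (Ideal.Quotient.mk _ X) (n + 1)
  rw [h0, map_zero, Nat.add_sub_cancel, ← Nat.cast_smul_eq_nsmul (TruncPS R (n + 1))] at h1
  have hu := isUnit_natCast_succ k (TruncPS R (n + 1)) n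
  rw [eq_comm, Nat.cast_add_one, hu.smul_eq_zero] at h1
  rw [mul_comm, map_mul, map_pow]
  exact (mul_smul (Ideal.Quotient.mk _ h) _ _).trans (by rw [h1, smul_zero])

theorem truncOmegaMap_injective (k : Type u) [Field k] [CharZero k] [Algebra k R] (n : ℕ) :
    Function.Injective (truncOmegaMap R n) := by
  rw [injective_iff_map_eq_zero]
  intro w hw
  obtain ⟨f, rfl⟩ := exists_smul_D_eq R (n + 1) w
  rw [truncOmegaMap_smul_D, derivative_X, mul_one, Ideal.Quotient.eq_zero_iff_mem] at hw
  exact smul_D_eq_zero R k n hw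

theorem omegaMap_smul_D (n : ℕ) (f g : R⟦X⟧) :
    omegaMap (Ideal.Quotient.factorₐ R (Ideal.pow_le_pow_right n.le_succ))
      (Ideal.Quotient.mk (maxIdeal R ^ (n + 1)) f •
        D R (TruncPS R (n + 1)) (Ideal.Quotient.mk _ g)) =
      Ideal.Quotient.mk (maxIdeal R ^ n) f • D R (TruncPS R n) (Ideal.Quotient.mk _ g) := by
  simp only [omegaMap, LinearMap.restrictScalars_apply, map_smul, KaehlerDifferential.map_D]
  rfl

theorem factor_truncOmegaMap (n : ℕ) (w : Ω[TruncPS R (n + 2)⁄R]) :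
    Ideal.Quotient.factor (Ideal.pow_le_pow_right n.le_succ :
      maxIdeal R ^ (n + 1) ≤ maxIdeal R ^ n) (truncOmegaMap R (n + 1) w) =
      truncOmegaMap R n (omegaMap
        (Ideal.Quotient.factorₐ R (Ideal.pow_le_pow_right (n + 1).le_succ)) w) := by
  obtain ⟨f, rfl⟩ := exists_smul_D_eq R (n + 2) w
  rw [omegaMap_smul_D, truncOmegaMap_smul_D, truncOmegaMap_smul_D, Ideal.Quotient.factor_mk]

/-- The compatible family `dz`. -/
def contOmegaDX : ContOmega R :=
  ⟨fun n => D R (TruncPS R n) (Ideal.Quotient.mk _ X), fun n => by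
    simp only [omegaMap, LinearMap.restrictScalars_apply, KaehlerDifferential.map_D]
    rfl⟩

end TruncOmega

/-! ### Isomorphisms on differentials -/

section Criterion

attribute [local instance] truncModule

theorem tensorOmega_induction {k R A : Type u} [Field k] [CommRing R] [CommRing A] [Algebra k A]
    [Algebra A R⟦X⟧] {n : ℕ} {P : TruncPS R n ⊗[A] Ω[A⁄k] → Prop} (zero : P 0)
    (add : ∀ v w, P v → P w → P (v + w)) (tmul : ∀ (b : R⟦X⟧) a,
      P (Ideal.Quotient.mk (maxIdeal R ^ n) b ⊗ₜ D k A a)) (w) : P w := by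
  induction w using TensorProduct.induction_on with
  | zero => exact zero
  | add a b ha hb => exact add _ _ ha hb
  | tmul b ω =>
    have hω : ω ∈ Submodule.span A (Set.range (D k A)) := by
      rw [KaehlerDifferential.span_range_derivation]; trivial
    induction hω using Submodule.span_induction generalizing b with
    | zero => rw [TensorProduct.tmul_zero]; exact zero
    | add a c _ _ ha hc => rw [TensorProduct.tmul_add]; exact add _ _ (ha b) (hc b)
    | smul a c _ hc => rw [← TensorProduct.smul_tmul]; exact hc _
    | mem c hc =>
      obtain ⟨a, rfl⟩ := hc
      obtain ⟨b, rfl⟩ := Ideal.Quotient.mk_surjective b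
      exact tmul b a

variable (k R A : Type u) [Field k] [CommRing R] [Algebra k R] [CommRing A] [Algebra k A]
variable [Algebra A R⟦X⟧] [IsScalarTower k A R⟦X⟧]

/-- The derivation `a ↦ d(x(a))/dz` of `A` in `R[[z]]`. -/
def jetDerivation : Derivation k A R⟦X⟧ :=
  ((derivative R).restrictScalars k).compAlgebraMap A

/-- The map `R[z]/zⁿ ⊗_A Ω¹_A → R[z]/zⁿ`, `b ⊗ da ↦ b d(x(a))/dz`. -/
def jetOmegaMap (n : ℕ) : TruncPS R n ⊗[A] Ω[A⁄k] →ₗ[TruncPS R n] TruncPS R n :=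
  (((Ideal.Quotient.mkₐ A (maxIdeal R ^ n)).toLinearMap.compDer
    (jetDerivation k R A)).liftKaehlerDifferential).liftBaseChange (TruncPS R n)

theorem jetOmegaMap_tmul_D (n : ℕ) (b : TruncPS R n) (a : A) :
    jetOmegaMap k R A n (b ⊗ₜ D k A a) =
      b * Ideal.Quotient.mk _ (derivative R (algebraMap A R⟦X⟧ a)) := by
  rw [jetOmegaMap, LinearMap.liftBaseChange_tmul, Derivation.liftKaehlerDifferential_comp_D]
  rfl

theorem factor_jetOmegaMap (n : ℕ) (w : TruncPS R (n + 1) ⊗[A] Ω[A⁄k]) :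
    Ideal.Quotient.factor (Ideal.pow_le_pow_right n.le_succ :
      maxIdeal R ^ (n + 1) ≤ maxIdeal R ^ n) (jetOmegaMap k R A (n + 1) w) =
    jetOmegaMap k R A n (LinearMap.rTensor Ω[A⁄k]
      (Ideal.Quotient.factorₐ A (Ideal.pow_le_pow_right n.le_succ)).toLinearMap w) := by
  induction w using tensorOmega_induction with
  | zero => simp
  | add v w hv hw => rw [map_add, map_add, hv, hw, map_add, map_add]
  | tmul b a =>
    rw [jetOmegaMap_tmul_D, LinearMap.rTensor_tmul, jetOmegaMap_tmul_D, map_mul,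
      Ideal.Quotient.factor_mk]
    rfl

theorem truncOmegaMap_pullbackMapTrunc (n : ℕ) (w : TruncPS R (n + 1) ⊗[A] Ω[A⁄k]) :
    truncOmegaMap R n (pullbackMapTrunc k R A (n + 1) w) =
    jetOmegaMap k R A n (LinearMap.rTensor Ω[A⁄k]
      (Ideal.Quotient.factorₐ A (Ideal.pow_le_pow_right n.le_succ)).toLinearMap w) := by
  induction w using tensorOmega_induction with
  | zero => simp
  | add v w hv hw => rw [map_add, map_add, hv, hw, map_add, map_add]
  | tmul b a =>
    rw [LinearMap.rTensor_tmul, jetOmegaMap_tmul_D, pullbackMapTrunc,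
      LinearMap.liftBaseChange_tmul, KaehlerDifferential.map_D]
    exact truncOmegaMap_smul_D R n b _

/-- The ideal of `R` generated by the derivatives at `z = 0` of a jet. -/
def derivIdeal : Ideal R := Ideal.span (Set.range fun a : A => coeff 1 (algebraMap A R⟦X⟧ a))

-- The image is an ideal. If the derivatives at `z = 0` generate `R`, this ideal contains the class
-- of a series with constant term 1, which is a unit.
variable {R A} in
theorem jetOmegaMap_surjective (h : derivIdeal R A = ⊤) (n : ℕ) :
    Function.Surjective (jetOmegaMap k R A n) := by
  rw [← LinearMap.range_eq_top]
  let I : Ideal R⟦X⟧ := Ideal.comap (Ideal.Quotient.mk (maxIdeal R ^ n))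
    (LinearMap.range (jetOmegaMap k R A n))
  have hI : derivIdeal R A ≤ I.map constantCoeff := by
    rw [derivIdeal, Ideal.span_le]
    rintro _ ⟨a, rfl⟩
    have : derivative R (algebraMap A R⟦X⟧ a) ∈ I :=
      ⟨1 ⊗ₜ D k A a, by rw [jetOmegaMap_tmul_D, one_mul]⟩
    have := Ideal.mem_map_of_mem constantCoeff this
    rwa [constantCoeff_derivative] at this
  rw [h, top_le_iff, Ideal.eq_top_iff_one,
    Ideal.mem_map_iff_of_surjective _ constantCoeff_surj] at hI
  obtain ⟨f, hf, hf1⟩ := hI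
  have hu : IsUnit f := isUnit_iff_constantCoeff.2 (by rw [hf1]; exact isUnit_one)
  have hT : I = ⊤ := Ideal.eq_top_of_isUnit_mem _ hf hu
  have h1 : (1 : R⟦X⟧) ∈ I := by rw [hT]; trivial
  exact (Ideal.eq_top_iff_one _).2 (by simpa [I] using h1)

/-- At level `n + 1` the differentials of the truncated ring only see `R[z]/zⁿ`, so the truncated
pullback maps lose a degree and bijectivity appears only in the limit. The maps `jetOmegaMap` have
the right size at every level, and `truncOmegaMap_pullbackMapTrunc` relates the two with a shift by
one. -/
theorem bijective_pullbackMap_iff [CharZero k] (hA : LocallyCyclic A Ω[A⁄k]) :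
    Function.Bijective (pullbackMap k R A) ↔ derivIdeal R A = ⊤ := by
  constructor
  · intro hb
    obtain ⟨w, hw⟩ := hb.2 (contOmegaDX R)
    -- Level 2 is the lowest one with information: there `dz` corresponds to `1` in `R[z]/z = R`,
    -- which exhibits `1` as an element of the ideal of derivatives.
    have h2 : pullbackMapTrunc k R A 2 (w.1 2) = D R (TruncPS R 2) (Ideal.Quotient.mk _ X) :=
      congrFun (congrArg Subtype.val hw) 2
    have h1 := truncOmegaMap_pullbackMapTrunc k R A 1 (w.1 2)
    rw [w.2 1, h2, ← one_smul (TruncPS R 2) (D R _ _), ← map_one (Ideal.Quotient.mk _),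
      truncOmegaMap_smul_D, derivative_X, mul_one] at h1
    have key : ∀ v : TruncPS R 1 ⊗[A] Ω[A⁄k], ∃ f : R⟦X⟧,
        jetOmegaMap k R A 1 v = Ideal.Quotient.mk _ f ∧ constantCoeff f ∈ derivIdeal R A := by
      intro v
      induction v using tensorOmega_induction with
      | zero => exact ⟨0, by simp, by simp⟩
      | add v w hv hw =>
        obtain ⟨f, hf, hf'⟩ := hv
        obtain ⟨g, hg, hg'⟩ := hw
        exact ⟨f + g, by rw [map_add, hf, hg, map_add], by
          rw [map_add]; exact Ideal.add_mem _ hf' hg'⟩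
      | tmul b a =>
        refine ⟨b * derivative R (algebraMap A R⟦X⟧ a), by rw [jetOmegaMap_tmul_D, map_mul], ?_⟩
        rw [map_mul]
        refine Ideal.mul_mem_left _ _ (Ideal.subset_span ⟨a, ?_⟩)
        rw [constantCoeff_derivative]
    obtain ⟨f, hf, hf'⟩ := key (w.1 1)
    rw [hf, Ideal.Quotient.eq, pow_one, mem_maxIdeal_iff, map_sub, map_one, sub_eq_zero] at h1
    rw [Ideal.eq_top_iff_one, h1]
    exact hf'
  · intro h
    have hL : ∀ n, Function.Bijective (jetOmegaMap k R A n) := fun n =>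
      hA.bijective_of_surjective (jetOmegaMap_surjective k h n)
    constructor
    · intro w w' hww
      apply Subtype.ext
      funext n
      apply (hL n).1
      rw [← w.2 n, ← w'.2 n, ← truncOmegaMap_pullbackMapTrunc, ← truncOmegaMap_pullbackMapTrunc]
      exact congrArg (truncOmegaMap R n) (congrFun (congrArg Subtype.val hww) (n + 1))
    · intro η
      -- Component `n` of the preimage is determined by component `n + 1` of `η`, because of the
      -- lost degree.
      choose w hw using fun n => (hL n).2 (truncOmegaMap R n (η.1 (n + 1)))
      have hc : ∀ n, LinearMap.rTensor Ω[A⁄k] (Ideal.Quotient.factorₐ A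
          (Ideal.pow_le_pow_right n.le_succ)).toLinearMap (w (n + 1)) = w n := by
        intro n
        apply (hL n).1
        rw [← factor_jetOmegaMap, hw, hw, factor_truncOmegaMap, η.2]
      refine ⟨⟨w, hc⟩, Subtype.ext (funext fun n => ?_)⟩
      change pullbackMapTrunc k R A n (w n) = η.1 n
      cases n with
      | zero =>
        have : Subsingleton (TruncPS R 0) := 
          Ideal.Quotient.subsingleton_iff.2 (by rw [pow_zero, Ideal.one_eq_top])
        have := Module.subsingleton (TruncPS R 0) Ω[TruncPS R 0⁄R]
        exact Subsingleton.elim _ _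
      | succ n =>
        apply truncOmegaMap_injective R k
        rw [truncOmegaMap_pullbackMapTrunc, hc, hw]

end Criterion

/-! ### Coordinates on smooth curves -/

section SmoothCurve

variable {k A : Type u} [Field k] [CommRing A] [Algebra k A]

/-- In a submersive presentation of dimension 1 exactly one variable is not matched with a relation.
Its differential is a basis of `Ω¹`, hence generates it freely. -/
theorem exists_isCoordinate_of_isStandardSmooth
    [h : Algebra.IsStandardSmoothOfRelativeDimension 1 k A] :
    ∃ t : A, IsCoordinate k t ∧ ∀ a : A, a • D k A t = 0 → a = 0 := by
  classical
  obtain ⟨ι, σ, _, _, P, hP⟩ := h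
  have hcard : Nat.card ((Set.range P.map)ᶜ : Set ι) = 1 := by
    have h1 := Nat.card_congr (Equiv.Set.sumCompl (Set.range P.map))
    rw [Nat.card_sum, Nat.card_range_of_injective P.map_inj] at h1
    rw [Algebra.Presentation.dimension] at hP
    omega
  obtain ⟨i, hi⟩ := Nat.card_eq_one_iff_exists.1 hcard
  refine ⟨P.val i, ?_, fun a ha => ?_⟩
  · rw [IsCoordinate, eq_top_iff, ← P.basisKaehler.span_eq, Submodule.span_le]
    rintro _ ⟨i', rfl⟩
    rw [hi i', P.basisKaehler_apply]
    exact Submodule.mem_span_singleton_self _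
  · rw [← P.basisKaehler_apply] at ha
    have := congrArg (fun m => P.basisKaehler.repr m i) ha
    simpa only [map_smul, Finsupp.smul_apply, Module.Basis.repr_self, Finsupp.single_eq_same,
      smul_eq_mul, mul_one, map_zero, Finsupp.zero_apply] using this

/-- The algebra `A` is smooth of relative dimension one over `k`. -/
abbrev IsSmoothCurve (k A : Type u) [Field k] [CommRing A] [Algebra k A] : Prop :=
  RingHom.Locally (RingHom.IsStandardSmoothOfRelativeDimension 1) (algebraMap k A)

theorem IsSmoothCurve.exists_span_eq_top (h : IsSmoothCurve k A) :
    ∃ s : Set A, Ideal.span s = ⊤ ∧ ∀ g ∈ s, ∃ t : Localization.Away g, IsCoordinate k t ∧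
      ∀ a : Localization.Away g, a • D k (Localization.Away g) t = 0 → a = 0 := by
  obtain ⟨s, hs, h⟩ := h
  refine ⟨s, hs, fun g hg => ?_⟩
  have := h g hg
  rw [← IsScalarTower.algebraMap_eq,
    RingHom.isStandardSmoothOfRelativeDimension_algebraMap] at this
  exact exists_isCoordinate_of_isStandardSmooth

/-- Clear denominators: after localization at `g` the module is generated by some `dt`, and `e` is a
lift of `gⁿ dt`. -/
theorem IsSmoothCurve.locallyCyclic (h : IsSmoothCurve k A) : LocallyCyclic A Ω[A⁄k] := by
  obtain ⟨s, hs, h⟩ := h.exists_span_eq_top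
  refine ⟨s, hs, fun g hg => ?_⟩
  obtain ⟨t, ht, -⟩ := h g hg
  let B := Localization.Away g
  let f : Ω[A⁄k] →ₗ[A] Ω[B⁄k] := KaehlerDifferential.map k k A B
  have hf : IsLocalizedModule (Submonoid.powers g) f :=
    KaehlerDifferential.isLocalizedModule_map k A B (Submonoid.powers g)
  obtain ⟨⟨e, ⟨_, n, rfl⟩⟩, he⟩ := IsLocalizedModule.surj (Submonoid.powers g) f (D k B t)
  replace he : g ^ n • D k B t = f e := he
  refine ⟨e, fun m => ?_⟩
  have hm : f m ∈ Submodule.span B {D k B t} := by rw [ht]; trivial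
  obtain ⟨c, hc⟩ := Submodule.mem_span_singleton.1 hm
  obtain ⟨⟨c₀, ⟨_, l, rfl⟩⟩, hc₀⟩ := IsLocalization.surj (Submonoid.powers g) c
  replace hc₀ : c * algebraMap A B (g ^ l) = algebraMap A B c₀ := hc₀
  have h1 : f (g ^ (l + n) • m) = f (c₀ • e) := by
    rw [map_smul, map_smul, ← hc, ← he, ← algebraMap_smul B c₀, ← hc₀, pow_add, mul_smul,
      smul_comm (g ^ n) c, ← algebraMap_smul B (g ^ l) (c • _), smul_smul, mul_comm]
  obtain ⟨⟨_, q, rfl⟩, hq⟩ := (IsLocalizedModule.eq_iff_exists (Submonoid.powers g) f).1 h1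
  replace hq : g ^ q • g ^ (l + n) • m = g ^ q • c₀ • e := hq
  exact ⟨q + (l + n), g ^ q * c₀, by rw [pow_add, mul_smul, hq, mul_smul]⟩

theorem IsCoordinate.localizationAway {t : A} (ht : IsCoordinate k t) (g : A) :
    IsCoordinate k (algebraMap A (Localization.Away g) t) := by
  rw [IsCoordinate, eq_top_iff, ← KaehlerDifferential.span_range_map_derivation_of_isLocalization
    k A (Localization.Away g) (Submonoid.powers g), Submodule.span_le]
  rintro _ ⟨a, rfl⟩
  have : D k A a ∈ Submodule.span A {D k A t} := by rw [ht]; trivial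
  obtain ⟨c, hc⟩ := Submodule.mem_span_singleton.1 this
  rw [Function.comp_apply, ← hc, map_smul, KaehlerDifferential.map_D,
    ← algebraMap_smul (Localization.Away g)]
  exact Submodule.smul_mem _ _ (Submodule.mem_span_singleton_self _)

/-- A coordinate is only required to generate `Ω¹`; smoothness makes it a free generator. Locally
`dt` is a unit multiple of a free generator `dt'`, since each is a multiple of the other. The
derivation `∂_t` exists for this reason. -/
theorem IsCoordinate.smul_D_eq_zero (hA : IsSmoothCurve k A) {t : A} (ht : IsCoordinate k t)
    {a : A} (ha : a • D k A t = 0) : a = 0 := by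
  obtain ⟨s, hs, h⟩ := hA.exists_span_eq_top
  refine Localization.algebraMap_injective_of_span_eq_top s hs (funext fun g => ?_)
  obtain ⟨t', ht', htf⟩ := h g.1 g.2
  let B := Localization.Away g.1
  change algebraMap A B a = algebraMap A B 0
  have h1 : D k B t' ∈ Submodule.span B {D k B (algebraMap A B t)} := by
    rw [ht.localizationAway g.1]; trivial
  have h2 : D k B (algebraMap A B t) ∈ Submodule.span B {D k B t'} := by rw [ht']; trivial
  obtain ⟨c, hc⟩ := Submodule.mem_span_singleton.1 h1
  obtain ⟨e, he⟩ := Submodule.mem_span_singleton.1 h2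
  have hce : c * e = 1 := by
    rw [← sub_eq_zero]
    apply htf
    rw [sub_smul, mul_smul, he, hc, one_smul, sub_self]
  have h3 := congrArg (KaehlerDifferential.map k k A B) ha
  rw [map_smul, map_zero, KaehlerDifferential.map_D, ← algebraMap_smul B, ← he, smul_smul] at h3
  have h4 := htf _ h3
  rw [map_zero, ← mul_one (algebraMap A B a), ← hce, mul_comm c, ← mul_assoc, h4, zero_mul]

theorem IsCoordinate.exists_derivation (hA : IsSmoothCurve k A) {t : A} (ht : IsCoordinate k t) :
    ∃ d : Derivation k A A, d t = 1 := by
  have hb : Function.Bijective (LinearMap.toSpanSingleton A Ω[A⁄k] (D k A t)) := by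
    constructor
    · rw [injective_iff_map_eq_zero]
      intro a ha
      exact ht.smul_D_eq_zero hA ha
    · rw [← LinearMap.range_eq_top, LinearMap.range_toSpanSingleton]
      exact ht
  let e := LinearEquiv.ofBijective _ hb
  refine ⟨e.symm.toLinearMap.compDer (D k A), ?_⟩
  change e.symm (D k A t) = 1
  rw [LinearEquiv.symm_apply_eq]
  exact (one_smul A _).symm

theorem IsCoordinate.isUnit_derivation {t s : A} (hs : IsCoordinate k s) {d : Derivation k A A}
    (hd : d t = 1) : IsUnit (d s) := by
  have : D k A t ∈ Submodule.span A {D k A s} := by rw [hs]; trivial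
  obtain ⟨c, hc⟩ := Submodule.mem_span_singleton.1 this
  have h := congrArg d.liftKaehlerDifferential hc
  rw [map_smul, Derivation.liftKaehlerDifferential_comp_D,
    Derivation.liftKaehlerDifferential_comp_D, hd] at h
  exact IsUnit.of_mul_eq_one_right c h

/-- The automorphism `u` of the change of coordinates. -/
theorem exists_changeCoordinate {t s : A} (hs : IsCoordinate k s) {d : Derivation k A A}
    (hd : d t = 1) : ∃ u : AutPlus A, u.1 X = PowerSeries.mk
      (fun n => if n = 0 then 0 else algebraMap k A (n.factorial : k)⁻¹ * d^[n] s) :=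
  AutPlus.exists_apply_X _ (by rw [← coeff_zero_eq_constantCoeff_apply, coeff_mk, if_pos rfl])
    (by simpa using hs.isUnit_derivation hd)

end SmoothCurve

/-! ### The derivative of a jet -/

section JetIdeal

variable {k R S A B : Type u} [Field k] [CommRing R] [Algebra k R] [CommRing S] [Algebra k S]
  [CommRing A] [Algebra k A] [CommRing B] [Algebra k B]

/-- The ideal of `R` generated by the derivatives at `z = 0` of a jet `φ : A → R[[z]]`. -/
def jetIdeal (φ : A →ₐ[k] R⟦X⟧) : Ideal R := Ideal.span (Set.range fun a : A => coeff 1 (φ a))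

theorem isIsoOnOmega_iff [CharZero k] (hA : IsSmoothCurve k A) (φ : A →ₐ[k] R⟦X⟧) :
    IsIsoOnOmega φ ↔ jetIdeal φ = ⊤ := by
  let := φ.toRingHom.toAlgebra
  have : IsScalarTower k A R⟦X⟧ := IsScalarTower.of_algebraMap_eq fun c => (φ.commutes c).symm
  exact bijective_pullbackMap_iff k R A hA.locallyCyclic

theorem jetIdeal_map (f : R →ₐ[k] S) (φ : A →ₐ[k] R⟦X⟧) :
    jetIdeal ((PowerSeries.mapAlgHom f).comp φ) = (jetIdeal φ).map f := by
  rw [jetIdeal, jetIdeal, Ideal.map_span, ← Set.range_comp]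
  congr 2

theorem jetIdeal_smul_le (ρ : AutPlus R) (φ : A →ₐ[k] R⟦X⟧) :
    jetIdeal ((ρ.1.toAlgHom.restrictScalars k).comp φ) ≤ jetIdeal φ := by
  rw [jetIdeal, Ideal.span_le]
  rintro _ ⟨a, rfl⟩
  change coeff 1 (ρ.1 (φ a)) ∈ jetIdeal φ
  rw [AutPlus.coeff_one_apply]
  exact Ideal.mul_mem_left _ _ (Ideal.subset_span ⟨a, rfl⟩)

theorem coeff_one_mul (f g : R⟦X⟧) :
    coeff 1 (f * g) = constantCoeff f * coeff 1 g + constantCoeff g * coeff 1 f := by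
  rw [coeff_mul, Finset.Nat.antidiagonal_succ]
  simp [mul_comm]

/-- Modulo the ideal coming from `A`, the linear coefficient of `φ` is an `A`-derivation of `B`, and
these vanish because `Ω¹` of `B` over `A` is zero. This allows shrinking of charts. -/
theorem jetIdeal_comp (i : A →ₐ[k] B) (hi : i.toRingHom.FormallyUnramified) (φ : B →ₐ[k] R⟦X⟧) :
    jetIdeal (φ.comp i) = jetIdeal φ := by
  apply le_antisymm
  · rw [jetIdeal, Ideal.span_le]
    rintro _ ⟨a, rfl⟩
    exact Ideal.subset_span ⟨i a, rfl⟩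
  · rw [jetIdeal, Ideal.span_le]
    rintro _ ⟨b, rfl⟩
    let : Algebra A B := i.toRingHom.toAlgebra
    have : Algebra.FormallyUnramified A B := hi
    set I := jetIdeal (φ.comp i)
    let : Module B (R ⧸ I) := Module.compHom _
      ((Ideal.Quotient.mk I).comp ((evalZero k R).comp φ).toRingHom)
    let : Module A (R ⧸ I) := Module.compHom _ i.toRingHom
    have hsmul : ∀ (b : B) (r : R),
        b • Ideal.Quotient.mk I r = Ideal.Quotient.mk I (constantCoeff (φ b) * r) :=
      fun _ _ => rfl
    have hsmul' : ∀ (a : A) (r : R),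
        a • Ideal.Quotient.mk I r = Ideal.Quotient.mk I (constantCoeff (φ (i a)) * r) :=
      fun _ _ => rfl
    have : IsScalarTower A B (R ⧸ I) := ⟨fun a b r => by
      obtain ⟨r, rfl⟩ := Ideal.Quotient.mk_surjective r
      rw [hsmul, hsmul, hsmul', Algebra.smul_def, map_mul φ, map_mul constantCoeff, mul_assoc]
      rfl⟩
    have hmul : ∀ b b' : B, Ideal.Quotient.mk I (coeff 1 (φ (b * b'))) =
        b • Ideal.Quotient.mk I (coeff 1 (φ b')) + b' • Ideal.Quotient.mk I (coeff 1 (φ b)) :=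
      fun b b' => by rw [hsmul, hsmul, ← map_add, map_mul, coeff_one_mul]
    have hzero : ∀ a, Ideal.Quotient.mk I (coeff 1 (φ (i a))) = 0 := fun a =>
      Ideal.Quotient.eq_zero_iff_mem.2 (Ideal.subset_span ⟨a, rfl⟩)
    let d : Derivation A B (R ⧸ I) := Derivation.mk'
      { toFun := fun b => Ideal.Quotient.mk I (coeff 1 (φ b))
        map_add' := fun b b' => by rw [map_add, map_add, map_add]
        map_smul' := fun a b => by
          change Ideal.Quotient.mk I (coeff 1 (φ (i a * b))) = _
          rw [hmul, hzero, smul_zero, add_zero]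
          rfl } hmul
    have hd : d b = 0 := by
      rw [← d.liftKaehlerDifferential_comp_D, Subsingleton.elim (D A B b) 0, map_zero]
    exact Ideal.Quotient.eq_zero_iff_mem.1 hd

/-- The ideal is generated by the value at `t` alone: modulo that value, the linear coefficient of
`φ` is a derivation killing the coordinate. -/
theorem jetIdeal_eq_top_iff {t : A} (ht : IsCoordinate k t) (φ : A →ₐ[k] R⟦X⟧) :
    jetIdeal φ = ⊤ ↔ IsUnit (coeff 1 (φ t)) := by
  suffices h : jetIdeal φ = Ideal.span {coeff 1 (φ t)} by rw [h, Ideal.span_singleton_eq_top]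
  apply le_antisymm
  · rw [jetIdeal, Ideal.span_le]
    rintro _ ⟨a, rfl⟩
    set I : Ideal R := Ideal.span {coeff 1 (φ t)}
    let : Module A (R ⧸ I) := Module.compHom _
      ((Ideal.Quotient.mk I).comp ((evalZero k R).comp φ).toRingHom)
    have hsmul : ∀ (a : A) (r : R),
        a • Ideal.Quotient.mk I r = Ideal.Quotient.mk I (constantCoeff (φ a) * r) :=
      fun _ _ => rfl
    have : IsScalarTower k A (R ⧸ I) := ⟨fun c a r => by
      obtain ⟨r, rfl⟩ := Ideal.Quotient.mk_surjective r
      rw [hsmul, hsmul, map_smul, ← coeff_zero_eq_constantCoeff_apply, coeff_smul,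
        coeff_zero_eq_constantCoeff_apply, smul_mul_assoc]
      rfl⟩
    let d : Derivation k A (R ⧸ I) := Derivation.mk'
      { toFun := fun b => Ideal.Quotient.mk I (coeff 1 (φ b))
        map_add' := fun b b' => by rw [map_add, map_add, map_add]
        map_smul' := fun c b => by
          rw [map_smul, coeff_smul]
          rfl }
      fun b b' => by
        change Ideal.Quotient.mk I (coeff 1 (φ (b * b'))) =
          b • Ideal.Quotient.mk I (coeff 1 (φ b')) + b' • Ideal.Quotient.mk I (coeff 1 (φ b))
        rw [hsmul, hsmul, ← map_add, map_mul, coeff_one_mul]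
    exact Ideal.Quotient.eq_zero_iff_mem.1 (ht.derivation_eq_zero d
      (Ideal.Quotient.eq_zero_iff_mem.2 (Ideal.mem_span_singleton_self _)) a)
  · rw [Ideal.span_singleton_le_iff_mem]
    exact Ideal.subset_span ⟨t, rfl⟩

end JetIdeal

/-! ### Points and charts -/

section Charts

variable {k : Type u} [Field k] {C : Scheme.{u}} {p : C ⟶ Spec (CommRingCat.of k)}
  {R S T A B : Type u} [CommRing R] [Algebra k R] [CommRing S] [Algebra k S] [CommRing T]
  [Algebra k T] [CommRing A] [Algebra k A] [CommRing B] [Algebra k B]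

theorem Pt.map_map (f : R →ₐ[k] S) (g : S →ₐ[k] T) (x : Pt p R) :
    Pt.map g (Pt.map f x) = Pt.map (g.comp f) x := by
  apply Subtype.ext
  change Spec.map _ ≫ Spec.map _ ≫ x.1 = Spec.map _ ≫ x.1
  rw [← Category.assoc, ← Spec.map_comp]
  rfl

theorem Pt.map_injective (j : Pt p A) [Mono j.1] {φ ψ : A →ₐ[k] R}
    (h : Pt.map φ j = Pt.map ψ j) : φ = ψ := by
  have h1 := Spec.map_injective ((cancel_mono j.1).1 (congrArg Subtype.val h))
  ext a
  exact congrArg (fun f => f.hom a) h1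

theorem Pt.exists_eq_map (j : Pt p A) [IsOpenImmersion j.1] (y : Pt p R)
    (h : Set.range y.1 ⊆ Set.range j.1) : ∃ φ : A →ₐ[k] R, y = Pt.map φ j := by
  let l := IsOpenImmersion.lift j.1 y.1 h
  let f := Spec.preimage l
  have hl : l ≫ j.1 = y.1 := IsOpenImmersion.lift_fac ..
  have hf : Spec.map f = l := Spec.map_preimage l
  have hk : f.hom.comp (algebraMap k A) = algebraMap k R := by
    have : Spec.map (CommRingCat.ofHom (algebraMap k A) ≫ f) =
        Spec.map (CommRingCat.ofHom (algebraMap k R)) := by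
      rw [Spec.map_comp, hf, ← j.2, ← y.2, ← Category.assoc, hl]
    exact congrArg (fun g => g.hom) (Spec.map_injective this)
  refine ⟨{ f.hom with commutes' := fun c => RingHom.congr_fun hk c }, Subtype.ext ?_⟩
  rw [← hl, ← hf]
  rfl

theorem Pt.range_map_subset (f : R →ₐ[k] S) (x : Pt p R) :
    Set.range (Pt.map f x).1 ⊆ Set.range x.1 := by
  rintro _ ⟨q, rfl⟩
  exact ⟨Spec.map (CommRingCat.ofHom f.toRingHom) q, rfl⟩

theorem exists_pt (p : C ⟶ Spec (CommRingCat.of k)) {B : Type u} [CommRing B]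
    (f : Spec (CommRingCat.of B) ⟶ C) : ∃ (_ : Algebra k B) (j : Pt p B), j.1 = f := by
  let := (Spec.preimage (f ≫ p)).hom.toAlgebra
  exact ⟨this, ⟨f, (Spec.map_preimage (f ≫ p)).symm⟩, rfl⟩

theorem exists_pt_of_isAffineOpen (p : C ⟶ Spec (CommRingCat.of k)) {U : C.Opens}
    (hU : IsAffineOpen U) : ∃ (A : Type u) (_ : CommRing A) (_ : Algebra k A) (j : Pt p A),
      IsOpenImmersion j.1 ∧ Set.range j.1 = U := by
  obtain ⟨a, j, hj⟩ := exists_pt p (B := Γ(C, U)) hU.fromSpec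
  refine ⟨Γ(C, U), inferInstance, a, j, ?_, ?_⟩
  · rw [hj]; infer_instance
  · rw [hj]; exact hU.range_fromSpec

theorem Pt.isSmoothCurve [SmoothOfRelativeDimension 1 p] (j : Pt p A) [IsOpenImmersion j.1] :
    IsSmoothCurve k A := by
  have h : SmoothOfRelativeDimension (0 + 1) (j.1 ≫ p) := inferInstance
  rw [j.2] at h
  exact (HasRingHomProperty.Spec_iff (P := @SmoothOfRelativeDimension 1)).1 h

theorem exists_coordinate_chart (p : C ⟶ Spec (CommRingCat.of k)) [SmoothOfRelativeDimension 1 p]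
    (c : C) : ∃ (A : Type u) (_ : CommRing A) (_ : Algebra k A) (j : Pt p A),
      IsOpenImmersion j.1 ∧ c ∈ Set.range j.1 ∧ ∃ t : A, IsCoordinate k t := by
  obtain ⟨U, hU, hc, -⟩ := exists_isAffineOpen_mem_and_subset (x := c) (U := ⊤) trivial
  obtain ⟨A, _, _, j, _, hj⟩ := exists_pt_of_isAffineOpen p hU
  obtain ⟨q, rfl⟩ : c ∈ Set.range j.1 := by rw [hj]; exact hc
  obtain ⟨s, hs, h⟩ := (Pt.isSmoothCurve j).exists_span_eq_top
  obtain ⟨g, hg, hgq⟩ : ∃ g ∈ s, g ∉ q.asIdeal := by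
    by_contra! hcon
    exact q.isPrime.ne_top (top_le_iff.1 (hs ▸ Ideal.span_le.2 hcon))
  obtain ⟨t, ht, -⟩ := h g hg
  refine ⟨Localization.Away g, inferInstance, inferInstance,
    Pt.map (IsScalarTower.toAlgHom k A (Localization.Away g)) j, ?_, ?_, t, ht⟩
  · have : IsOpenImmersion (Spec.map (CommRingCat.ofHom (algebraMap A (Localization.Away g)))) :=
      inferInstance
    exact inferInstanceAs (IsOpenImmersion
      (Spec.map (CommRingCat.ofHom (algebraMap A (Localization.Away g))) ≫ j.1))
  · have hq : q ∈ Set.range (PrimeSpectrum.comap (algebraMap A (Localization.Away g))) := by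
      rw [PrimeSpectrum.localization_away_comap_range (Localization.Away g) g]
      exact hgq
    obtain ⟨q', rfl⟩ := hq
    exact ⟨q', rfl⟩

/-- Since `z` lies in the Jacobson radical of `R[[z]]`, every point of the spectrum specializes to a
point of `Spec R`, and open sets are stable under generization. So a jet lies in a chart as soon as
its base point does. -/
theorem Jet.range_subset (y : Jet p R) (U : C.Opens) (h : Set.range y.base.1 ⊆ U) :
    Set.range y.1 ⊆ U := by
  rintro _ ⟨q, rfl⟩
  obtain ⟨m, hm, hqm⟩ := Ideal.exists_le_maximal q.asIdeal q.isPrime.ne_top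
  have hX : (X : R⟦X⟧) ∈ m := by
    have : (X : R⟦X⟧) ∈ Ideal.jacobson ⊥ := by
      rw [Ideal.mem_jacobson_bot]
      intro f
      rw [isUnit_iff_constantCoeff]
      simp
    exact Ideal.mem_sInf.1 this ⟨bot_le, hm⟩
  let m' : PrimeSpectrum R⟦X⟧ := ⟨m, hm.isPrime⟩
  have hr : m' ∈ Set.range (PrimeSpectrum.comap (constantCoeff : R⟦X⟧ →+* R)) := by
    rw [range_comap_of_surjective _ _ constantCoeff_surj]
    intro f hf
    obtain ⟨g, rfl⟩ := X_dvd_iff.2 hf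
    exact Ideal.mul_mem_right _ _ hX
  obtain ⟨r, hr⟩ := hr
  have hmU : y.1 m' ∈ U := h ⟨r, by rw [← hr]; rfl⟩
  have hs : (q : PrimeSpectrum R⟦X⟧) ⤳ m' := (PrimeSpectrum.le_iff_specializes _ _).1 hqm
  exact (hs.map y.1.continuous).mem_open U.isOpen hmU

theorem Jet.exists_eq_map (j : Pt p A) [IsOpenImmersion j.1] (y : Jet p R)
    (h : Set.range y.base.1 ⊆ Set.range j.1) : ∃ φ : A →ₐ[k] R⟦X⟧, y = Pt.map φ j :=
  Pt.exists_eq_map j y (Jet.range_subset y j.1.opensRange h)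

theorem Jet.base_map (f : R →ₐ[k] S) (y : Jet p R) :
    (Jet.map f y).base = Pt.map f y.base := by
  rw [Jet.base, Jet.base, Jet.map, Pt.map_map, Pt.map_map]
  rfl

theorem Jet.map_map (f : R →ₐ[k] S) (g : S →ₐ[k] T) (y : Jet p R) :
    Jet.map g (Jet.map f y) = Jet.map (g.comp f) y := by
  rw [Jet.map, Jet.map, Pt.map_map]
  rfl

theorem Jet.map_pt_map (f : R →ₐ[k] S) (φ : A →ₐ[k] R⟦X⟧) (j : Pt p A) :
    Jet.map f (Pt.map φ j) = Pt.map ((PowerSeries.mapAlgHom f).comp φ) j :=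
  Pt.map_map _ _ _

theorem Jet.smul_pt_map (ρ : AutPlus R) (φ : A →ₐ[k] R⟦X⟧) (j : Pt p A) :
    ρ • (Pt.map φ j : Jet p R) = Pt.map ((ρ.1.toAlgHom.restrictScalars k).comp φ) j :=
  Pt.map_map _ _ _

theorem Jet.map_smul (f : R →ₐ[k] S) (ρ : AutPlus R) (y : Jet p R) :
    Jet.map f (ρ • y) = AutPlus.map f.toRingHom ρ • Jet.map f y := by
  change Pt.map _ (Pt.map _ y) = Pt.map _ (Pt.map _ y)
  rw [Pt.map_map, Pt.map_map]
  congr 1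
  ext1 g
  exact (AutPlus.map_apply_map f.toRingHom ρ g).symm

theorem Jet.base_smul (ρ : AutPlus R) (y : Jet p R) : (ρ • y).base = y.base := by
  change Pt.map _ (Pt.map _ y) = Pt.map _ y
  rw [Pt.map_map]
  congr 1
  ext1 g
  exact AutPlus.constantCoeff_apply ρ g

theorem Jet.base_pt_map_eq_iff (j : Pt p A) [Mono j.1] (φ : A →ₐ[k] R⟦X⟧) (x : A →ₐ[k] R) :
    Jet.base (Pt.map φ j) = Pt.map x j ↔ ∀ a, constantCoeff (φ a) = x a := by
  rw [Jet.base, Pt.map_map]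
  refine ⟨fun h a => ?_, fun h => ?_⟩
  · exact congrArg (fun f => f a) (Pt.map_injective j h)
  · congr 1
    ext a
    exact h a

/-- Two points of a separated scheme are equal if they are so after a jointly injective family of
base changes. -/
theorem Pt.ext_of_jointly_injective [IsSeparated p] {ι : Type u} {S : ι → Type u}
    [∀ i, CommRing (S i)] [∀ i, Algebra k (S i)] (f : ∀ i, R →ₐ[k] S i)
    (hf : ∀ r, (∀ i, f i r = 0) → r = 0) {y y' : Pt p R}
    (h : ∀ i, Pt.map (f i) y = Pt.map (f i) y') : y = y' := by
  let X' : Over (Spec (CommRingCat.of k)) := Over.mk (y.1 ≫ p)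
  let Y' : Over (Spec (CommRingCat.of k)) := Over.mk p
  let g : X' ⟶ Y' := Over.homMk y.1
  let g' : X' ⟶ Y' := Over.homMk y'.1 (y'.2.trans y.2.symm)
  have : IsSeparated Y'.hom := ‹_›
  -- By separatedness the locus where `y` and `y'` agree is a closed subscheme `Spec (R/I)`. Every
  -- `f i` factors through `R/I`, so joint injectivity forces `I = 0`.
  obtain ⟨I, e, he⟩ := IsClosedImmersion.Spec_iff.1
    (isClosedImmersion_equalizer_ι_left g g')
  have hI : I = ⊥ := by
    rw [eq_bot_iff]
    intro r hr
    refine hf r fun i => ?_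
    let W : Over (Spec (CommRingCat.of k)) :=
      Over.mk (Spec.map (CommRingCat.ofHom (f i).toRingHom) ≫ y.1 ≫ p)
    let l : W ⟶ X' := Over.homMk (Spec.map (CommRingCat.ofHom (f i).toRingHom))
    have hl : l ≫ g = l ≫ g' := by
      ext1
      exact congrArg Subtype.val (h i)
    have h1 : (Limits.equalizer.lift l hl).left ≫ (Limits.equalizer.ι g g').left = l.left := by
      rw [← Over.comp_left, Limits.equalizer.lift_ι]
    rw [he] at h1
    let q := Spec.preimage ((Limits.equalizer.lift l hl).left ≫ e.hom)
    have h2 : Spec.map (CommRingCat.ofHom (Ideal.Quotient.mk I) ≫ q) =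
        Spec.map (CommRingCat.ofHom (f i).toRingHom) := by
      rw [Spec.map_comp, Spec.map_preimage, Category.assoc]
      exact h1
    have h3 := congrArg (fun φ => φ.hom r) (Spec.map_injective h2)
    change q.hom (Ideal.Quotient.mk I r) = f i r at h3
    rw [← h3, Ideal.Quotient.eq_zero_iff_mem.2 hr, map_zero]
  have hc : (Limits.equalizer.ι g g').left ≫ y.1 = (Limits.equalizer.ι g g').left ≫ y'.1 :=
    congrArg (fun φ => φ.left) (Limits.equalizer.condition g g')
  rw [he, Category.assoc, Category.assoc, cancel_epi] at hc
  have hb : Function.Bijective (Ideal.Quotient.mk I) := by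
    refine ⟨?_, Ideal.Quotient.mk_surjective⟩
    rw [RingHom.injective_iff_ker_eq_bot, Ideal.mk_ker, hI]
  have : IsIso (CommRingCat.ofHom (Ideal.Quotient.mk I)) :=
    (ConcreteCategory.isIso_iff_bijective _).2 hb
  exact Subtype.ext ((cancel_epi _).1 hc)

/-- The jet factors through the intersection of the two charts, which is affine because `p` is
separated. Open immersions are formally unramified, so `jetIdeal_comp` compares each chart with the
intersection. -/
theorem jetIdeal_eq_of_pt_map_eq [IsSeparated p] (j : Pt p A) [IsOpenImmersion j.1] (j' : Pt p B)
    [IsOpenImmersion j'.1] {φ : A →ₐ[k] R⟦X⟧} {φ' : B →ₐ[k] R⟦X⟧}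
    (h : Pt.map φ j = Pt.map φ' j') : jetIdeal φ = jetIdeal φ' := by
  have : IsAffineHom (Limits.pullback.diagonal p) := inferInstance
  have hW : IsAffineOpen (j.1.opensRange ⊓ j'.1.opensRange) :=
    isAffineHom_diagonal_iff.1 this ⊤ (isAffineOpen_top _) _ (by simp) _ (by simp)
      (isAffineOpen_opensRange _) (isAffineOpen_opensRange _)
  obtain ⟨E, _, _, e, _, he⟩ := exists_pt_of_isAffineOpen p hW
  replace he : Set.range e.1 = Set.range j.1 ∩ Set.range j'.1 := he
  obtain ⟨χ, hχ⟩ := Pt.exists_eq_map e (Pt.map φ j) (by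
    rw [he]
    refine Set.subset_inter (Pt.range_map_subset _ _) ?_
    rw [h]
    exact Pt.range_map_subset _ _)
  have key : ∀ {A' : Type u} [CommRing A'] [Algebra k A'] (i : Pt p A') [IsOpenImmersion i.1]
      (ψ : A' →ₐ[k] R⟦X⟧), Set.range e.1 ⊆ Set.range i.1 → Pt.map ψ i = Pt.map χ e →
      jetIdeal ψ = jetIdeal χ := by
    intro A' _ _ i _ ψ hr hψ
    obtain ⟨ι, rfl⟩ := Pt.exists_eq_map i e hr
    rw [Pt.map_map] at hψ
    rw [Pt.map_injective i hψ]
    apply jetIdeal_comp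
    have h1 : IsOpenImmersion (Spec.map (CommRingCat.ofHom ι.toRingHom) ≫ i.1) :=
      ‹IsOpenImmersion (Pt.map ι i).1›
    have h2 : IsOpenImmersion (Spec.map (CommRingCat.ofHom ι.toRingHom)) :=
      IsOpenImmersion.of_comp _ i.1
    exact (HasRingHomProperty.Spec_iff (P := @FormallyUnramified)
      (φ := CommRingCat.ofHom ι.toRingHom)).1 inferInstance
  rw [key j φ (by rw [he]; exact Set.inter_subset_left) hχ,
    key j' φ' (by rw [he]; exact Set.inter_subset_right) (h.symm.trans hχ)]

end Charts

/-! ### The torsor `Aut_C` -/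

section AutC

variable {k : Type u} [Field k] {C : Scheme.{u}} {p : C ⟶ Spec (CommRingCat.of k)}
  {R S A : Type u} [CommRing R] [Algebra k R] [CommRing S] [Algebra k S] [CommRing A] [Algebra k A]

theorem Pt.exists_away_range_subset (x : Pt p R) (q : PrimeSpectrum R) (U : C.Opens)
    (h : x.1 q ∈ U) : ∃ f ∉ q.asIdeal,
      Set.range (Pt.map (IsScalarTower.toAlgHom k R (Localization.Away f)) x).1 ⊆ U := by
  let V : TopologicalSpace.Opens (PrimeSpectrum R) := x.1 ⁻¹ᵁ U
  obtain ⟨_, ⟨f, rfl⟩, hq, hf⟩ :=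
    PrimeSpectrum.isTopologicalBasis_basic_opens.exists_subset_of_mem_open
      (show q ∈ (V : Set (PrimeSpectrum R)) from h) V.isOpen
  refine ⟨f, hq, ?_⟩
  rintro _ ⟨q', rfl⟩
  have : PrimeSpectrum.comap (algebraMap R (Localization.Away f)) q' ∈
      (PrimeSpectrum.basicOpen f : Set (PrimeSpectrum R)) := by
    rw [← PrimeSpectrum.localization_away_comap_range (Localization.Away f) f]
    exact ⟨q', rfl⟩
  exact hf this

theorem Pt.apply_comap_mem (f : R →ₐ[k] S) (x : Pt p R) (q : PrimeSpectrum S) {Z : Set C}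
    (h : Set.range (Pt.map f x).1 ⊆ Z) : x.1 (PrimeSpectrum.comap f.toRingHom q) ∈ Z :=
  h ⟨q, rfl⟩

theorem FormalIso.toJet_act (j : Pt p A) {x : A →ₐ[k] R} (ρ : AutPlus R) (φ : FormalIso x) :
    (FormalIso.act ρ φ).toJet j = ρ • φ.toJet j :=
  (Jet.smul_pt_map ρ φ.toHom j).symm

theorem FormalIso.act_injective {x : A →ₐ[k] R} (φ : FormalIso x) {ρ ρ' : AutPlus R}
    (h : FormalIso.act ρ φ = FormalIso.act ρ' φ) : ρ = ρ' := by
  apply Subtype.ext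
  ext1 g
  have h1 := congrArg (fun ψ : FormalIso x => ψ.1 (φ.1.symm g)) h
  change ρ.1 (φ.1 (φ.1.symm g)) = ρ'.1 (φ.1 (φ.1.symm g)) at h1
  rwa [AlgEquiv.apply_symm_apply] at h1

variable [CharZero k] [SmoothOfRelativeDimension 1 p]

theorem jetIdeal_eq_top_of_mem_autC {y : Jet p R} (hy : y ∈ AutC p R) (j : Pt p A)
    [IsOpenImmersion j.1] (f : R) (φ : A →ₐ[k] (Localization.Away f)⟦X⟧)
    (h : Jet.map (IsScalarTower.toAlgHom k R (Localization.Away f)) y = Pt.map φ j) :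
    jetIdeal φ = ⊤ :=
  (isIsoOnOmega_iff j.isSmoothCurve φ).1 (hy A j f φ h)

/-- The charts tested over `S` need not come from charts over `R`, so the unit ideal is tested at
residue fields. At a maximal ideal the same chart `j` works over a localization of `R` at some `f'`,
and both jets become equal over the residue field. -/
theorem map_mem_autC (f : R →ₐ[k] S) {y : Jet p R} (hy : y ∈ AutC p R) :
    Jet.map f y ∈ AutC p S := by
  intro A _ _ j _ g φ hφ
  rw [isIsoOnOmega_iff j.isSmoothCurve]
  by_contra hne
  obtain ⟨q, hq, hle⟩ := Ideal.exists_le_maximal _ hne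
  let q' : PrimeSpectrum (Localization.Away g) := ⟨q, hq.isPrime⟩
  let π := Ideal.Quotient.mkₐ k q
  let h₀ : R →ₐ[k] Localization.Away g := (IsScalarTower.toAlgHom k S (Localization.Away g)).comp f
  rw [Jet.map_map] at hφ
  let q₀ : PrimeSpectrum R := PrimeSpectrum.comap h₀.toRingHom q'
  have hmem : y.base.1 q₀ ∈ j.1.opensRange := by
    refine Pt.apply_comap_mem h₀ y.base q' ?_
    rw [← Jet.base_map, hφ, Jet.base, Pt.map_map]
    exact Pt.range_map_subset _ _
  obtain ⟨f', hf', hsub⟩ := Pt.exists_away_range_subset y.base q₀ j.1.opensRange hmem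
  obtain ⟨φ', hφ'⟩ := Jet.exists_eq_map j
    (Jet.map (IsScalarTower.toAlgHom k R (Localization.Away f')) y) (by
      rw [Jet.base_map]; exact hsub)
  have htop := jetIdeal_eq_top_of_mem_autC hy j f' φ' hφ'
  let _ : Field (Localization.Away g ⧸ q) := Ideal.Quotient.field q
  have hunit : ∀ r : Submonoid.powers f', IsUnit ((π.comp h₀) r) := by
    rintro ⟨_, n, rfl⟩
    rw [map_pow]
    refine IsUnit.pow n (Ne.isUnit fun h0 => hf' ?_)
    exact (Ideal.Quotient.eq_zero_iff_mem (I := q) (a := h₀ f')).1 h0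
  let e : Localization.Away f' →ₐ[k] Localization.Away g ⧸ q := IsLocalization.liftAlgHom hunit
  have he : e.comp (IsScalarTower.toAlgHom k R (Localization.Away f')) = π.comp h₀ :=
    AlgHom.ext fun r => IsLocalization.lift_eq _ r
  have hφφ : (PowerSeries.mapAlgHom e).comp φ' = (PowerSeries.mapAlgHom π).comp φ := by
    apply Pt.map_injective j
    rw [← Jet.map_pt_map, ← Jet.map_pt_map, ← hφ', ← hφ, Jet.map_map, Jet.map_map, he]
  have h1 : (jetIdeal φ).map π = ⊤ := by
    rw [← jetIdeal_map, ← hφφ, jetIdeal_map, htop, Ideal.map_top]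
  have h2 : (jetIdeal φ).map π ≤ ⊥ := by
    rw [Ideal.map_le_iff_le_comap]
    intro r hr
    exact Ideal.Quotient.eq_zero_iff_mem.2 (hle hr)
  rw [h1, top_le_iff] at h2
  exact bot_ne_top h2

theorem smul_mem_autC (ρ : AutPlus R) {y : Jet p R} (hy : y ∈ AutC p R) : ρ • y ∈ AutC p R := by
  intro A _ _ j _ f φ hφ
  rw [isIsoOnOmega_iff j.isSmoothCurve]
  -- Move `ρ` to the other side: `jetIdeal` of `ρ⁻¹ ∘ φ` is the unit ideal and is contained in that
  -- of `φ`.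
  rw [Jet.map_smul, eq_comm, ← inv_smul_eq_iff, Jet.smul_pt_map] at hφ
  have h := jetIdeal_eq_top_of_mem_autC hy j f _ hφ.symm
  exact top_le_iff.1 (h ▸ jetIdeal_smul_le _ φ)

variable [IsSeparated p]

/-- For a jet inside a chart, this chart alone decides: independence of the chart and base change
take care of all others. The converse tests the localization at `1`. -/
theorem pt_map_mem_autC_iff (j : Pt p A) [IsOpenImmersion j.1] (φ : A →ₐ[k] R⟦X⟧) :
    Pt.map φ j ∈ AutC p R ↔ jetIdeal φ = ⊤ := by
  constructor
  · intro h
    have h1 := jetIdeal_eq_top_of_mem_autC h j 1 _ (Jet.map_pt_map _ φ j)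
    rw [jetIdeal_map] at h1
    by_contra hne
    refine (IsLocalization.map_algebraMap_ne_top_iff_disjoint (Submonoid.powers (1 : R))
      (Localization.Away (1 : R)) (jetIdeal φ)).2 ?_ h1
    rw [Set.disjoint_left]
    rintro _ ⟨n, rfl⟩ hn
    exact hne ((Ideal.eq_top_iff_one _).2 (by simpa using hn))
  · intro h B _ _ j' _ f φ' h'
    rw [Jet.map_pt_map] at h'
    rw [isIsoOnOmega_iff j'.isSmoothCurve, ← jetIdeal_eq_of_pt_map_eq j j' h', jetIdeal_map, h,
      Ideal.map_top]

theorem bijOn_toJet (j : Pt p A) [IsOpenImmersion j.1] {t : A} (ht : IsCoordinate k t)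
    (x : A →ₐ[k] R) : Set.BijOn (fun φ : FormalIso x => φ.toJet j) Set.univ
      {y | y ∈ AutC p R ∧ y.base = Pt.map x j} := by
  obtain ⟨d, hd⟩ := ht.exists_derivation j.isSmoothCurve
  obtain ⟨ψ, hψ, -⟩ := existsUnique_isRho ht hd x
  refine ⟨fun φ _ => ⟨?_, ?_⟩, fun φ _ φ' _ h => ?_, ?_⟩
  · exact (pt_map_mem_autC_iff j _).2 ((jetIdeal_eq_top_iff ht _).2 (φ.isUnit_coeff_one_toHom hψ))
  · exact (Jet.base_pt_map_eq_iff j _ x).2 φ.constantCoeff_toHom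
  · exact FormalIso.ext_coordinate hψ (congrArg (fun f => f t) (Pt.map_injective j h))
  · rintro y ⟨hy, hyx⟩
    obtain ⟨χ, rfl⟩ := Jet.exists_eq_map j y (by rw [hyx]; exact Pt.range_map_subset _ _)
    rw [pt_map_mem_autC_iff, jetIdeal_eq_top_iff ht] at hy
    obtain ⟨ρ, hρ⟩ := FormalIso.exists_act_toHom_eq ht hψ
      ((Jet.base_pt_map_eq_iff j χ x).1 hyx) hy
    exact ⟨FormalIso.act ρ ψ, trivial, by rw [← hρ]; rfl⟩

/-- Bijectivity combines `bijOn_toJet` with the fact that the isomorphisms at `x` are the `ρ ∘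
ρ^x_t`. Naturality holds for any choice of the family `rho`, since its jets are forced to be the
Taylor jets. -/
theorem isTrivialization_of_isRho (j : Pt p A) [IsOpenImmersion j.1] {t : A}
    (ht : IsCoordinate k t)
    (rho : ∀ (R : Type u) [CommRing R] [Algebra k R] (x : A →ₐ[k] R), FormalIso x)
    (hrho : ∀ (R : Type u) [CommRing R] [Algebra k R] (x : A →ₐ[k] R), (rho R x).IsRho t) :
    IsTrivialization (fun R _ _ => AutC p R) j
      (fun R _ _ x ρ => (FormalIso.act ρ (rho R x)).toJet j) where
  bijOn R _ _ x := by
    refine (bijOn_toJet j ht x).comp (f := fun ρ => FormalIso.act ρ (rho R x)) ?_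
    refine ⟨fun _ _ => trivial, fun ρ _ ρ' _ h => FormalIso.act_injective _ h, fun φ _ => ?_⟩
    obtain ⟨ρ, hρ⟩ := φ.exists_act_eq (rho R x) (hrho R x)
    exact ⟨ρ, trivial, hρ⟩
  equivariant R _ _ x σ ρ := FormalIso.toJet_act j σ (FormalIso.act ρ (rho R x))
  natural R S _ _ _ _ f x ρ := by
    obtain ⟨d, hd⟩ := ht.exists_derivation j.isSmoothCurve
    rw [FormalIso.toJet_act, FormalIso.toJet_act, Jet.map_smul]
    congr 1
    rw [FormalIso.toJet, FormalIso.toJet, Jet.map_pt_map, (hrho R x).toHom_eq ht hd,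
      (hrho S _).toHom_eq ht hd]
    rfl

theorem existsUnique_smul_eq_of_coordinate (j : Pt p A) [IsOpenImmersion j.1] {t : A}
    (ht : IsCoordinate k t) {y y' : Jet p R} (hy : y ∈ AutC p R) (hy' : y' ∈ AutC p R)
    (h : y.base = y'.base) (hj : Set.range y.base.1 ⊆ Set.range j.1) :
    ∃! ρ : AutPlus R, ρ • y = y' := by
  obtain ⟨x, hx⟩ := Pt.exists_eq_map j y.base hj
  obtain ⟨d, hd⟩ := ht.exists_derivation j.isSmoothCurve
  obtain ⟨ψ, hψ, -⟩ := existsUnique_isRho ht hd x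
  have hb := bijOn_toJet j ht x
  obtain ⟨φ, -, rfl⟩ := hb.surjOn ⟨hy, hx⟩
  obtain ⟨φ', -, rfl⟩ := hb.surjOn ⟨hy', h.symm.trans hx⟩
  obtain ⟨ρ, rfl⟩ := φ.exists_act_eq ψ hψ
  obtain ⟨ρ', rfl⟩ := φ'.exists_act_eq ψ hψ
  simp only [FormalIso.toJet_act]
  refine ⟨ρ' * ρ⁻¹, ?_, fun σ hσ => ?_⟩
  · simp only [mul_smul, inv_smul_smul]
  · replace hσ : σ • ρ • ψ.toJet j = ρ' • ψ.toJet j := hσ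
    rw [smul_smul, ← FormalIso.toJet_act, ← FormalIso.toJet_act] at hσ
    rw [_root_.eq_mul_inv_iff_mul_eq]
    exact ψ.act_injective (hb.injOn trivial trivial hσ)

/-- The base point need not lie in a single chart, so the automorphism is found over localizations
of `R` where a coordinate exists. Uniqueness over every further base change makes the coefficients
of the series `ρ(z)` agree on overlaps, and they glue. -/
theorem existsUnique_smul_eq {y y' : Jet p R} (hy : y ∈ AutC p R) (hy' : y' ∈ AutC p R)
    (h : y.base = y'.base) : ∃! ρ : AutPlus R, ρ • y = y' := by
  let π (f : R) : R →ₐ[k] Localization.Away f := IsScalarTower.toAlgHom k R (Localization.Away f)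
  let s : Set R := {f | ∃ (A : Type u) (_ : CommRing A) (_ : Algebra k A) (j : Pt p A) (t : A),
    IsOpenImmersion j.1 ∧ IsCoordinate k t ∧
      Set.range (Pt.map (π f) y.base).1 ⊆ Set.range j.1}
  have hs : Ideal.span s = ⊤ := by
    by_contra hne
    obtain ⟨q, hq, hle⟩ := Ideal.exists_le_maximal _ hne
    let q' : PrimeSpectrum R := ⟨q, hq.isPrime⟩
    obtain ⟨A, _, _, j, _, hj, t, ht⟩ := exists_coordinate_chart p (y.base.1 q')
    obtain ⟨f, hf, hsub⟩ := Pt.exists_away_range_subset y.base q' j.1.opensRange hj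
    exact hf (hle (Ideal.subset_span ⟨A, _, _, j, t, ‹_›, ht, hsub⟩))
  -- Arbitrary algebras over the localization are allowed so that uniqueness is also available on
  -- the overlaps.
  have hloc : ∀ (f : s) (S : Type u) [CommRing S] [Algebra k S] (g : Localization.Away f.1 →ₐ[k] S),
      ∃! ρ : AutPlus S, ρ • Jet.map (g.comp (π f.1)) y = Jet.map (g.comp (π f.1)) y' := by
    intro f S _ _ g
    obtain ⟨A, _, _, j, t, _, ht, hsub⟩ := f.2
    refine existsUnique_smul_eq_of_coordinate j ht (map_mem_autC _ hy) (map_mem_autC _ hy')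
      (by rw [Jet.base_map, Jet.base_map, h]) ?_
    rw [Jet.base_map, ← Pt.map_map]
    exact (Pt.range_map_subset _ _).trans hsub
  have hinj : ∀ a b : R, (∀ f : s, π f.1 a = π f.1 b) → a = b := fun a b hab =>
    Localization.algebraMap_injective_of_span_eq_top s hs (funext hab)
  choose ρ hρ hρu using fun f : s => hloc f (Localization.Away f.1) (AlgHom.id k _)
  simp only [AlgHom.id_comp] at hρ hρu
  have hglue : ∀ n, ∃ r : R, ∀ f : s, π f.1 r = coeff n ((ρ f).1 X) := by
    intro n
    refine (Localization.existsUnique_algebraMap_eq_of_span_eq_top s hs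
      (fun f => coeff n ((ρ f).1 X)) fun f g => ?_).exists
    let P := Localization.Away (f.1 * g.1)
    let r₁ : Localization.Away f.1 →+* P := IsLocalization.Away.awayToAwayRight f.1 g.1
    let r₂ : Localization.Away g.1 →+* P := IsLocalization.Away.awayToAwayLeft g.1 f.1
    have hr₁ : ∀ a, r₁ (π f.1 a) = algebraMap R P a :=
      IsLocalization.Away.awayToAwayRight_eq f.1 g.1
    have hr₂ : ∀ a, r₂ (π g.1 a) = algebraMap R P a :=
      IsLocalization.Away.awayToAwayLeft_eq g.1 f.1
    let e₁ : Localization.Away f.1 →ₐ[k] P := { r₁ with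
      commutes' := fun c => by
        rw [← (π f.1).commutes c, IsScalarTower.algebraMap_apply k R P]
        exact hr₁ _ }
    let e₂ : Localization.Away g.1 →ₐ[k] P := { r₂ with
      commutes' := fun c => by
        rw [← (π g.1).commutes c, IsScalarTower.algebraMap_apply k R P]
        exact hr₂ _ }
    have he : e₂.comp (π g.1) = e₁.comp (π f.1) :=
      AlgHom.ext fun a => (hr₂ a).trans (hr₁ a).symm
    have h1 : AutPlus.map e₁.toRingHom (ρ f) = AutPlus.map e₂.toRingHom (ρ g) := by
      refine (hloc f P e₁).unique ?_ ?_
      · rw [← Jet.map_map, ← Jet.map_map, ← Jet.map_smul, hρ]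
      · rw [← he, ← Jet.map_map, ← Jet.map_map, ← Jet.map_smul, hρ]
    have h2 := congrArg (fun σ : AutPlus P => coeff n (σ.1 X)) h1
    simp only [AutPlus.map_apply_X, coeff_map] at h2
    exact h2
  choose r hr using hglue
  have hmap : ∀ f : s, PowerSeries.map (π f.1).toRingHom (PowerSeries.mk r) = (ρ f).1 X := by
    intro f
    ext n
    rw [coeff_map, coeff_mk]
    exact hr n f
  obtain ⟨σ, hσ⟩ : ∃ σ : AutPlus R, σ.1 X = PowerSeries.mk r := by
    apply AutPlus.exists_apply_X
    · apply hinj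
      intro f
      rw [← coeff_zero_eq_constantCoeff_apply, coeff_mk, hr, coeff_zero_eq_constantCoeff_apply,
        AutPlus.constantCoeff_apply, constantCoeff_X, map_zero]
    · rw [coeff_mk]
      -- A nonunit lies in a maximal ideal `q`. Some `f` in the cover avoids `q`, so the
      -- localization at `f` maps to `R/q`, where the linear coefficient would be both a unit and
      -- zero.
      by_contra hne
      obtain ⟨q, hq, hrq⟩ := exists_max_ideal_of_mem_nonunits hne
      obtain ⟨f, hf, hfq⟩ : ∃ f ∈ s, f ∉ q := by
        by_contra! hcon
        exact hq.ne_top (top_le_iff.1 (hs ▸ Ideal.span_le.2 hcon))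
      let _ : Field (R ⧸ q) := Ideal.Quotient.field q
      have hunit : IsUnit (Ideal.Quotient.mk q f) :=
        Ne.isUnit fun h0 => hfq (Ideal.Quotient.eq_zero_iff_mem.1 h0)
      have h1 : IsUnit (IsLocalization.Away.lift (S := Localization.Away f) f hunit
          (algebraMap R _ (r 1))) := by
        refine IsUnit.map _ ?_
        have := hr 1 ⟨f, hf⟩
        change algebraMap R _ (r 1) = _ at this
        rw [this]
        exact AutPlus.isUnit_coeff_one _
      rw [IsLocalization.Away.lift_eq, Ideal.Quotient.eq_zero_iff_mem.2 hrq] at h1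
      exact not_isUnit_zero h1
  have hσρ : ∀ f : s, AutPlus.map (π f.1).toRingHom σ = ρ f := fun f =>
    AutPlus.ext_X (by rw [AutPlus.map_apply_X, hσ, hmap])
  refine ⟨σ, ?_, fun τ hτ => ?_⟩
  -- The spectra of the rings `R_f[[z]]` need not be open in that of `R[[z]]`, so equality of the
  -- two jets is deduced from separatedness and joint injectivity on coefficients.
  · refine Pt.ext_of_jointly_injective (ι := s) (fun f => PowerSeries.mapAlgHom (π f.1))
      (fun g hg => ?_) fun f => ?_
    · ext n
      refine hinj _ _ fun f => ?_
      have := congrArg (coeff n) (hg f)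
      rw [map_zero] at this ⊢
      rw [map_zero]
      rw [← this]
      exact (coeff_map _ _ _).symm
    · change Jet.map (π f.1) (σ • y) = Jet.map (π f.1) y'
      rw [Jet.map_smul, hσρ, hρ]
  · apply AutPlus.ext_X
    ext n
    refine hinj _ _ fun f => ?_
    have h1 : AutPlus.map (π f.1).toRingHom τ = ρ f := by
      apply hρu
      rw [← Jet.map_smul, hτ]
    have h2 := congrArg (fun σ : AutPlus (Localization.Away f.1) => coeff n (σ.1 X))
      (h1.trans (hσρ f).symm)
    simp only [AutPlus.map_apply_X, coeff_map] at h2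
    exact h2

end AutC

end CurveJets

end

open CurveJets

theorem mainTheorem2 {k : Type u} [Field k] [IsAlgClosed k] [CharZero k]
    (C : Scheme.{u}) (p : C ⟶ Spec (CommRingCat.of k))
    [IsSeparated p] [SmoothOfRelativeDimension 1 p] :
    -- `Aut_C → C` is a left `Aut⁺O`-torsor
    IsLeftTorsor (p := p) (fun R _ _ => AutC p R) ∧
    -- `j : Spec A ⟶ C` is an affine open `U` of `C` (all of `C` if `j` is an isomorphism)
    ∀ (A : Type u) [CommRing A] [Algebra k A] (j : Pt p A) [IsOpenImmersion j.1],
      (∀ t : A, IsCoordinate k t →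
        -- for `x ∈ U(R)`, the elements of `Aut_C(R)` over `x` are the pairs `(x, φ)`
        (∀ (R : Type u) [CommRing R] [Algebra k R] (x : A →ₐ[k] R),
          Set.BijOn (fun φ : FormalIso x => φ.toJet j) Set.univ
            {y | y ∈ AutC p R ∧ y.base = Pt.map x j}) ∧
        -- the isomorphisms `ρ^x_t` exist and are unique
        (∀ (R : Type u) [CommRing R] [Algebra k R] (x : A →ₐ[k] R),
          ∃! φ : FormalIso x, φ.IsRho t) ∧
        -- `ψ_t : (x, ρ) ↦ (x, ρ ρ^x_t)` is a trivialization over `U`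
        ∀ rho : ∀ (R : Type u) [CommRing R] [Algebra k R] (x : A →ₐ[k] R), FormalIso x,
          (∀ (R : Type u) [CommRing R] [Algebra k R] (x : A →ₐ[k] R), (rho R x).IsRho t) →
          IsTrivialization (fun R _ _ => AutC p R) j
            (fun R _ _ x ρ => (FormalIso.act ρ (rho R x)).toJet j)) ∧
      -- change of coordinates: `ψ_s⁻¹ ψ_t (x, ρ) = (x, ρ · x(u))` for the element `u` of `Aut⁺O(A)`
      -- with `u(z) = ∑_{n ≥ 1} (1/n!) ∂_tⁿ(s) zⁿ`
      ∀ t s : A, IsCoordinate k t → IsCoordinate k s →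
        ∃ d : Derivation k A A, d t = 1 ∧
          ∃ u : AutPlus A,
            u.1 X = PowerSeries.mk
              (fun n => if n = 0 then 0 else algebraMap k A (n.factorial : k)⁻¹ * d^[n] s) ∧
            ∀ (R : Type u) [CommRing R] [Algebra k R] (x : A →ₐ[k] R) (φ φ' : FormalIso x),
              φ.IsRho t → φ'.IsRho s → ∀ ρ : AutPlus R,
                (FormalIso.act ρ φ).toJet j = (FormalIso.act (ρ * AutPlus.map x.toRingHom u) φ').toJet j := by
  refine ⟨⟨fun R S _ _ _ _ f y hy => map_mem_autC f hy, fun R _ _ ρ y hy => smul_mem_autC ρ hy,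
    fun R S _ _ _ _ f ρ y _ => Jet.map_smul f ρ y, fun R _ _ ρ y _ => Jet.base_smul ρ y,
    fun R _ _ y y' hy hy' h => existsUnique_smul_eq hy hy' h, fun c => ?_⟩,
    fun A _ _ j _ => ⟨fun t ht => ⟨fun R _ _ x => bijOn_toJet j ht x, fun R _ _ x => ?_,
      fun rho hrho => isTrivialization_of_isRho j ht rho hrho⟩, fun t s ht hs => ?_⟩⟩
  · obtain ⟨A, _, _, j, _, hc, t, ht⟩ := exists_coordinate_chart p c
    obtain ⟨d, hd⟩ := ht.exists_derivation j.isSmoothCurve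
    choose rho hrho using fun (R : Type u) [CommRing R] [Algebra k R] (x : A →ₐ[k] R) =>
      (existsUnique_isRho ht hd x).exists
    exact ⟨A, _, _, j, ‹_›, hc, _, isTrivialization_of_isRho j ht rho hrho⟩
  · obtain ⟨d, hd⟩ := ht.exists_derivation j.isSmoothCurve
    exact existsUnique_isRho ht hd x
  · obtain ⟨d, hd⟩ := ht.exists_derivation j.isSmoothCurve
    obtain ⟨u, hu⟩ := exists_changeCoordinate hs hd
    refine ⟨d, hd, u, hu, fun R _ _ x φ φ' hφ hφ' ρ => ?_⟩
    rw [FormalIso.toJet_act, FormalIso.toJet_act, mul_smul, ← FormalIso.toJet_act j _ φ',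
      FormalIso.toJet, FormalIso.toJet,
      FormalIso.toHom_eq_changeCoordinate ht hs hd hu hφ hφ']
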